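/- Let $d\ge 2$, let $\tau_{d-1}$ be the uniform probability measure on the unit sphere $\mathbb{S}^{d-1}\subset\mathbb{R}^d$, let $S_{m}$ be the surface area of $\mathbb{S}^{m}$ (so $S_0=2$), and let $w_d(t)=\frac{S_{d-2}}{S_{d-1}}(1-t^2)^{\frac{d-3}{2}}$. For $k\ge 0$ let $N_{k,d}$ be defined by $\sum_{k\ge0}N_{k,d}s^k=\frac{1+s}{(1-s)^{d-1}}$, $|s|<1$, and let $P_{k,d}$ be the Legendre polynomial of degree $k$ in dimension $d$, $$P_{k,d}(t)=(-1)^k\frac{\Gamma(\frac{d-1}{2})}{2^k\,\Gamma(k+\frac{d-1}{2})}(1-t^2)^{-\frac{d-3}{2}}\Big(\frac{d}{dt}\Big)^k(1-t^2)^{k+\frac{d-3}{2}}\qquad(-1<t<1),$$ extended by continuity to $[-1,1]$. Let $f:[-1,1]\to\mathbb{R}$ be continuous with $f(1)=1$ and such that $K(x,z)=f(\langle x,z\rangle)$ is a positive definite kernel on $\mathbb{S}^{d-1}$, i.e. $\sum_{i,j}c_ic_jf(\langle x_i,x_j\rangle)\ge0$ for all finite systems of points $x_i\in\mathbb{S}^{d-1}$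 and reals $c_i$. Let $\alpha_k=N_{k,d}\int_{-1}^1 f(t)P_{k,d}(t)\,w_d(t)\,dt$ be the Legendre coefficients of $f$. Then $\alpha_k\ge0$ for all $k$, $f(t)=\sum_{k\ge0}\alpha_kP_{k,d}(t)$ for all $t\in[-1,1]$, and the series $$\sigma_f=\sum_{k=0}^\infty\sqrt{\alpha_kN_{k,d}}\;P_{k,d}$$ converges in $L^2([-1,1],w_d(t)\,dt)$. Its sum $\sigma_f$ (whichever representative is chosen) satisfies: (i) $\int_{-1}^1\sigma_f(t)^2\,w_d(t)\,dt=1$; (ii) for all $x,z\in\mathbb{S}^{d-1}$, the function $\xi\mapsto\sigma_f(\xi^\top x)\sigma_f(\xi^\top z)$ is $\tau_{d-1}$-integrable and $\mathbb{E}_{\xi\sim\tau_{d-1}}\big[\sigma_f(\xi^\top x)\,\sigma_f(\xi^\top z)\big]=f(\langle x,z\rangle)$. -/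

import Mathlib

open MeasureTheory Filter Topology Set

noncomputable section

namespace KernelActivation

/-- The unit sphere of `ℝ^d` (of dimension `d - 1`), as a type. -/
abbrev Sph (d : ℕ) : Type := Metric.sphere (0 : EuclideanSpace ℝ (Fin d)) 1

/-- `S_m`: the surface area of the unit sphere of dimension `m`, that is, of the unit sphere of
`ℝ^(m+1)`. For `m = 0` it is the number of points of `{-1, 1}`. -/
def sphereArea (m : ℕ) : ℝ :=
  (volume : Measure (EuclideanSpace ℝ (Fin (m + 1)))).toSphere.real univ

/-- The uniform probability measure `τ` on the unit sphere of `ℝ^d`: normalized surface measure. -/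
def unifSphere (d : ℕ) : Measure (Sph d) :=
  ((volume : Measure (EuclideanSpace ℝ (Fin d))).toSphere univ)⁻¹ •
    (volume : Measure (EuclideanSpace ℝ (Fin d))).toSphere

/-- `N_{k,d}`: the coefficient of `s^k` in `(1 + s) / (1 - s)^(d-1)`. -/
def harmonicDim (k d : ℕ) : ℝ :=
  PowerSeries.coeff k
    ((1 + PowerSeries.X) * ((1 - PowerSeries.X : PowerSeries ℝ) ^ (d - 1))⁻¹)

/-- The expression of Rodrigues' formula for the Legendre polynomial of degree `k` in dimension
`d`; it is meaningful for `-1 < t < 1`. -/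
def rodrigues (k d : ℕ) (t : ℝ) : ℝ :=
  (-1) ^ k * (Real.Gamma (((d : ℝ) - 1) / 2) / (2 ^ k * Real.Gamma ((k : ℝ) + ((d : ℝ) - 1) / 2)))
    * (1 - t ^ 2) ^ (-(((d : ℝ) - 3) / 2))
    * iteratedDeriv k (fun s : ℝ => (1 - s ^ 2) ^ ((k : ℝ) + ((d : ℝ) - 3) / 2)) t

/-- The Legendre polynomial `P_{k,d}` on `[-1, 1]`: Rodrigues' formula on `(-1, 1)`, extended by
continuity to the end points. -/
def legendreP (k d : ℕ) : ℝ → ℝ :=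
  extendFrom (Ioo (-1 : ℝ) 1) (rodrigues k d)

/-- The weight `(S_{d-2} / S_{d-1}) (1 - t²)^((d-3)/2)`, for `d ≥ 2`: the density on `[-1, 1]` of a
coordinate of a uniform random point of the unit sphere of `ℝ^d`. -/
def weight (d : ℕ) (t : ℝ) : ℝ :=
  sphereArea (d - 2) / sphereArea (d - 1) * (1 - t ^ 2) ^ (((d : ℝ) - 3) / 2)

/-- The measure on `[-1, 1]` with density `weight d`. -/
def weightMeasure (d : ℕ) : Measure ℝ :=
  (volume.restrict (Icc (-1 : ℝ) 1)).withDensity fun t => ENNReal.ofReal (weight d t)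

/-- The `k`-th coefficient of `f` in its expansion in the orthogonal system `P_{k,d}`, each of
which has squared norm `1 / N_{k,d}` with respect to `weight d`. -/
def legendreCoeff (d : ℕ) (f : ℝ → ℝ) (k : ℕ) : ℝ :=
  harmonicDim k d * ∫ t in (-1 : ℝ)..1, f t * legendreP k d t * weight d t

/-- The inner-product kernel `K(x, z) = f(⟨x, z⟩)` on the sphere, as a matrix indexed by it. -/
def innerKernel (d : ℕ) (f : ℝ → ℝ) : Matrix (Sph d) (Sph d) ℝ :=
  fun x z => f (inner ℝ (x : EuclideanSpace ℝ (Fin d)) (z : EuclideanSpace ℝ (Fin d)))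

/-- The kernel `f(⟨x, z⟩)` is positive definite in the sense of Schoenberg: it is symmetric, and
`∑ i j, c i * c j * f(⟨x i, x j⟩) ≥ 0` for all finite systems of points and real coefficients. -/
def IsPosDefKernel (d : ℕ) (f : ℝ → ℝ) : Prop :=
  (innerKernel d f).PosSemidef

/-- The partial sums of the series `∑ √(α_k N_{k,d}) P_{k,d}`, where `α_k` are the Legendre
coefficients of `f`. -/
def dualPartialSum (d : ℕ) (f : ℝ → ℝ) (n : ℕ) (t : ℝ) : ℝ :=
  ∑ k ∈ Finset.range n, √(legendreCoeff d f k * harmonicDim k d) * legendreP k d t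

/-- `σ` is (a representative of) the sum `∑ √(α_k N_{k,d}) P_{k,d}`, the series being convergent in
`L²` of the weight on `[-1, 1]`. At single points, `t = 1` for example, it may diverge. -/
def IsDualActivation (d : ℕ) (f σ : ℝ → ℝ) : Prop :=
  AEStronglyMeasurable σ (weightMeasure d) ∧
    Tendsto (fun n => eLpNorm (dualPartialSum d f n - σ) 2 (weightMeasure d)) atTop (𝓝 0)

end KernelActivation

end

namespace KernelActivation

open Polynomial

/-! ### Integration against powers of `1 - t ^ 2` -/

/-! Zonal functions convolve on the sphere, and each `P_k` is an eigenfunction: `∫ P_k(ξ·x) φ(ξ·z)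
dτ(ξ) = (∫ φ P_k w) P_k(x·z)` (Funk–Hecke, `integral_legPoly_dot_mul`). With `∫ P_k² w = 1 / N_k`
(`integral_legPoly_mul_self`), the convolution square of `σ = ∑ √(α_k N_k) P_k` is `∑ α_k P_k = f`:
`σ` is a convolution square root of `f`. The series converges in `L²` because its terms are
orthogonal with squared norms `α_k`, and `∑ α_k` is finite.

Funk–Hecke is obtained without spherical harmonics. Convolution with `φ` sends polynomials in `ξ·x`
to polynomials in `x·z` of no larger degree, and it is self-adjoint; hence the image of `P_k` has
degree at most `k`, is orthogonal to lower degrees, and is a multiple of `P_k`. This needs the law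
of `ξ·x` to be the weight (`map_inner_unifSphere`), which follows by comparing moments: rotation
invariance and integration by parts give the same recursion.

Positive definiteness, integrated against `c(x) c(z)`, gives a nonnegative quadratic form that
Funk–Hecke diagonalizes; `c = P_k` yields `α_k ≥ 0`. Testing with normalized powers `(1 + t)^m`,
which concentrate at `t = 1`, and bounding `f` by its supremum gives `∑ α_k < ∞`. As `|P_k| ≤ 1`,
the Legendre series converges uniformly, and its sum is `f` because a continuous function orthogonal
to all polynomials vanishes. -/

theorem intervalIntegrable_rpow_one_sub_sq {a : ℝ} (ha : -(1 / 2) ≤ a) :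
    IntervalIntegrable (fun t : ℝ => (1 - t ^ 2) ^ a) volume (-1) 1 := by
  -- The worst exponent `-1/2` (the case `d = 2`) is the derivative of `arcsin`; any larger one
  -- multiplies it by a continuous power.
  have h1 : IntervalIntegrable (fun t : ℝ => 1 / √(1 - t ^ 2)) volume (-1) 1 := by
    rw [intervalIntegrable_iff_integrableOn_Ioc_of_le (by norm_num)]
    refine intervalIntegral.integrableOn_deriv_of_nonneg Real.continuous_arcsin.continuousOn
      (fun x hx => Real.hasDerivAt_arcsin hx.1.ne' hx.2.ne) fun x _ => by positivity
  have h2 : IntervalIntegrable (fun t : ℝ => (1 - t ^ 2) ^ (a + 1 / 2) * (1 / √(1 - t ^ 2)))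
      volume (-1) 1 := by
    refine h1.continuousOn_mul (Continuous.continuousOn ?_)
    exact Continuous.rpow_const (by fun_prop) fun x => Or.inr (by linarith)
  rw [intervalIntegrable_iff_integrableOn_Ioo_of_le (by norm_num)] at h2 ⊢
  refine h2.congr_fun (fun t ht => ?_) measurableSet_Ioo
  have : 0 < 1 - t ^ 2 := by nlinarith [ht.1, ht.2]
  simp only
  rw [Real.rpow_add this, ← Real.sqrt_eq_rpow]
  have := (Real.sqrt_pos.2 this).ne'
  field_simp

theorem intervalIntegrable_mul_rpow_one_sub_sq {a : ℝ} (ha : -(1 / 2) ≤ a) {g : ℝ → ℝ}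
    (hg : ContinuousOn g (Icc (-1) 1)) :
    IntervalIntegrable (fun t : ℝ => g t * (1 - t ^ 2) ^ a) volume (-1) 1 :=
  (intervalIntegrable_rpow_one_sub_sq ha).continuousOn_mul (by rwa [uIcc_of_le (by norm_num)])

/-- Valid at `t = ±1` too: there both sides vanish because `a + 1 > 0`. -/
theorem rpow_one_sub_sq_succ {a : ℝ} (ha : -(1 / 2) ≤ a) {t : ℝ} (ht : t ∈ Icc (-1 : ℝ) 1) :
    (1 - t ^ 2) ^ (a + 1) = (1 - t ^ 2) * (1 - t ^ 2) ^ a := by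
  have : 0 ≤ 1 - t ^ 2 := by nlinarith [ht.1, ht.2]
  rw [Real.rpow_add_one' this (by linarith), mul_comm]

theorem hasDerivAt_rpow_one_sub_sq (a : ℝ) {t : ℝ} (ht : t ∈ Ioo (-1 : ℝ) 1) :
    HasDerivAt (fun s : ℝ => (1 - s ^ 2) ^ a) (-(2 * a) * t * (1 - t ^ 2) ^ (a - 1)) t := by
  have : 0 < 1 - t ^ 2 := by nlinarith [ht.1, ht.2]
  convert ((hasDerivAt_pow 2 t).const_sub 1).rpow_const (p := a) (Or.inl this.ne') using 1
  simp only [Nat.cast_ofNat, Nat.add_one_sub_one, pow_one]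
  ring

/-- The boundary terms vanish in the integral of the derivative of `r * (1 - t ^ 2) ^ (a + 1)`. -/
theorem integral_deriv_mul_rpow_one_sub_sq {a : ℝ} (ha : -(1 / 2) ≤ a) (r : ℝ[X]) :
    ∫ t in (-1 : ℝ)..1, (derivative r * (1 - X ^ 2) - C (2 * (a + 1)) * X * r).eval t *
      (1 - t ^ 2) ^ a = 0 := by
  have h := intervalIntegral.integral_eq_sub_of_hasDerivAt_of_le (a := (-1 : ℝ)) (b := 1)
    (f := fun t => r.eval t * (1 - t ^ 2) ^ (a + 1))
    (f' := fun t => (derivative r * (1 - X ^ 2) - C (2 * (a + 1)) * X * r).eval t *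
      (1 - t ^ 2) ^ a) (by norm_num) ?_ ?_ ?_
  · rw [h]
    have : a + 1 ≠ 0 := by linarith
    simp [Real.zero_rpow this]
  · refine (r.continuous.mul ?_).continuousOn
    exact Continuous.rpow_const (by fun_prop) fun x => Or.inr (by linarith)
  · intro t ht
    refine ((r.hasDerivAt t).fun_mul (hasDerivAt_rpow_one_sub_sq (a + 1) ht)).congr_deriv ?_
    rw [add_sub_cancel_right, rpow_one_sub_sq_succ ha (Ioo_subset_Icc_self ht)]
    simp
    ring
  · exact intervalIntegrable_mul_rpow_one_sub_sq ha (Polynomial.continuous _).continuousOn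

/-! ### The polynomials of Rodrigues' formula -/

/-- The polynomial `q` such that the `j`-th derivative of `(1 - t ^ 2) ^ a` is
`(1 - t ^ 2) ^ (a - j) * q`. -/
noncomputable def rodPoly (a : ℝ) : ℕ → ℝ[X]
  | 0 => 1
  | j + 1 => derivative (rodPoly a j) * (1 - X ^ 2) - C (2 * (a - j)) * X * rodPoly a j

theorem iteratedDeriv_rpow_one_sub_sq (a : ℝ) (j : ℕ) {t : ℝ} (ht : t ∈ Ioo (-1 : ℝ) 1) :
    iteratedDeriv j (fun s : ℝ => (1 - s ^ 2) ^ a) t =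
      (1 - t ^ 2) ^ (a - j) * (rodPoly a j).eval t := by
  induction j generalizing t with
  | zero => simp [rodPoly]
  | succ j ih =>
    have hev : iteratedDeriv j (fun s : ℝ => (1 - s ^ 2) ^ a) =ᶠ[𝓝 t]
        fun s => (1 - s ^ 2) ^ (a - j) * (rodPoly a j).eval s := by
      filter_upwards [Ioo_mem_nhds ht.1 ht.2] with s hs using ih hs
    rw [iteratedDeriv_succ, hev.deriv_eq,
      ((hasDerivAt_rpow_one_sub_sq (a - j) ht).fun_mul ((rodPoly a j).hasDerivAt t)).deriv]
    have : 0 < 1 - t ^ 2 := by nlinarith [ht.1, ht.2]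
    have h2 : (1 - t ^ 2) ^ (a - j) = (1 - t ^ 2) * (1 - t ^ 2) ^ (a - j - 1) := by
      rw [mul_comm, ← Real.rpow_add_one this.ne']; ring_nf
    rw [h2]
    push_cast
    rw [show a - (j + 1) = a - j - 1 by ring]
    simp [rodPoly]
    ring

theorem rodPoly_succ_coeff (a : ℝ) (j n : ℕ) :
    (rodPoly a (j + 1)).coeff (n + 1) = (n + 2) * (rodPoly a j).coeff (n + 2)
      - (n + 2 * (a - j)) * (rodPoly a j).coeff n := by
  -- Powers of `X` are pulled out one at a time so that `coeff_X_mul` applies.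
  have h1 : rodPoly a (j + 1) = derivative (rodPoly a j) - X * (X * derivative (rodPoly a j))
      - C (2 * (a - j)) * (X * rodPoly a j) := by
    rw [rodPoly]; ring
  rw [h1, coeff_sub, coeff_sub, coeff_derivative, coeff_X_mul, coeff_C_mul, coeff_X_mul]
  rcases n with _ | n
  · simp
    ring
  · rw [coeff_X_mul, coeff_derivative]
    push_cast
    ring

theorem natDegree_rodPoly_le (a : ℝ) (j : ℕ) : (rodPoly a j).natDegree ≤ j := by
  induction j with
  | zero => simp [rodPoly]
  | succ j ih =>
    rw [natDegree_le_iff_coeff_eq_zero]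
    intro N hN
    obtain ⟨n, rfl⟩ : ∃ n, N = n + 1 := ⟨N - 1, by omega⟩
    rw [rodPoly_succ_coeff, coeff_eq_zero_of_natDegree_lt (by omega),
      coeff_eq_zero_of_natDegree_lt (by omega)]
    simp

theorem coeff_rodPoly_self (a : ℝ) (j : ℕ) :
    (rodPoly a j).coeff j = (-1) ^ j * ∏ i ∈ Finset.range j, (2 * a - i) := by
  induction j with
  | zero => simp [rodPoly]
  | succ j ih =>
    rw [rodPoly_succ_coeff, ih, coeff_eq_zero_of_natDegree_lt
      ((natDegree_rodPoly_le a j).trans_lt (by omega)), Finset.prod_range_succ]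
    ring

theorem eval_one_rodPoly (a : ℝ) (j : ℕ) :
    (rodPoly a j).eval 1 = (-2) ^ j * ∏ i ∈ Finset.range j, (a - i) := by
  induction j with
  | zero => simp [rodPoly]
  | succ j ih =>
    rw [rodPoly, Finset.prod_range_succ]
    simp [ih]
    ring

/-- Integration by parts, `j` times. -/
theorem integral_mul_rodPoly {a : ℝ} {j : ℕ} (h : -(1 / 2) ≤ a - j) (r : ℝ[X]) :
    ∫ t in (-1 : ℝ)..1, (r * rodPoly a j).eval t * (1 - t ^ 2) ^ (a - j) =
      (-1) ^ j * ∫ t in (-1 : ℝ)..1, (derivative^[j] r).eval t * (1 - t ^ 2) ^ a := by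
  induction j generalizing r with
  | zero => simp [rodPoly]
  | succ j ih =>
    push_cast at h
    have h1 : -(1 / 2) ≤ a - j - 1 := by linarith
    have h0 := integral_deriv_mul_rpow_one_sub_sq h1 (r * rodPoly a j)
    have h2 := ih (by linarith) (derivative r)
    -- The two integrands add up to the derivative of `r * rodPoly a j * (1 - t ^ 2) ^ (a - j)`,
    -- whose integral is zero by `h0`.
    rw [Function.iterate_succ_apply, pow_succ, mul_right_comm, ← h2, mul_neg_one, eq_neg_iff_add_eq_zero,
      ← h0, ← intervalIntegral.integral_add]
    · refine intervalIntegral.integral_congr fun t ht => ?_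
      rw [uIcc_of_le (by norm_num)] at ht
      have h3 := rpow_one_sub_sq_succ h1 ht
      rw [sub_add_cancel] at h3
      rw [h3]
      push_cast
      rw [show a - (j + 1) = a - j - 1 by ring]
      simp [rodPoly, derivative_mul]
      ring
    · refine intervalIntegrable_mul_rpow_one_sub_sq (by push_cast; linarith)
        (Polynomial.continuous _).continuousOn
    · refine intervalIntegrable_mul_rpow_one_sub_sq (by linarith)
        (Polynomial.continuous _).continuousOn

/-- The polynomial that `legendreP k d` is on `[-1, 1]`. -/
noncomputable def legPoly (k d : ℕ) : ℝ[X] :=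
  C ((-1) ^ k * (Real.Gamma (((d : ℝ) - 1) / 2) /
    (2 ^ k * Real.Gamma ((k : ℝ) + ((d : ℝ) - 1) / 2)))) * rodPoly (k + ((d : ℝ) - 3) / 2) k

/-- The prefactor of Rodrigues' formula cancels the power of `1 - t ^ 2` left by `k` derivatives;
the remaining polynomial is its own continuous extension. -/
theorem legendreP_eq (k d : ℕ) {t : ℝ} (ht : t ∈ Icc (-1 : ℝ) 1) :
    legendreP k d t = (legPoly k d).eval t := by
  refine extendFrom_eq (by rwa [closure_Ioo (by norm_num)]) ?_
  refine ((legPoly k d).continuous.tendsto t |>.mono_left nhdsWithin_le_nhds).congr' ?_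
  filter_upwards [self_mem_nhdsWithin] with s hs
  have : 0 < 1 - s ^ 2 := by nlinarith [hs.1, hs.2]
  rw [rodrigues, iteratedDeriv_rpow_one_sub_sq _ _ hs, add_sub_cancel_left, legPoly, eval_mul,
    eval_C, Real.rpow_neg this.le]
  have := (Real.rpow_pos_of_pos this (((d : ℝ) - 3) / 2)).ne'
  field_simp

theorem natDegree_legPoly_le (k d : ℕ) : (legPoly k d).natDegree ≤ k :=
  (natDegree_C_mul_le _ _).trans (natDegree_rodPoly_le _ _)

theorem Gamma_add_nat {a : ℝ} (ha : 0 < a) (k : ℕ) :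
    Real.Gamma (k + a) = Real.Gamma a * ∏ i ∈ Finset.range k, (k + a - 1 - i) := by
  induction k with
  | zero => simp
  | succ k ih =>
    rw [Finset.prod_range_succ']
    push_cast
    rw [show (k : ℝ) + 1 + a = k + a + 1 by ring, Real.Gamma_add_one (by positivity), ih,
      Finset.prod_congr rfl fun (i : ℕ) _ =>
        show (k : ℝ) + a + 1 - 1 - ((i : ℝ) + 1) = k + a - 1 - i by ring]
    ring

theorem eval_one_legPoly (k : ℕ) {d : ℕ} (hd : 2 ≤ d) : (legPoly k d).eval 1 = 1 := by
  have hd' : (2 : ℝ) ≤ d := by exact_mod_cast hd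
  have ha : 0 < ((d : ℝ) - 1) / 2 := by linarith
  have hG := Gamma_add_nat ha k
  have h0 : Real.Gamma (k + ((d : ℝ) - 1) / 2) ≠ 0 := (Real.Gamma_pos_of_pos (by positivity)).ne'
  rw [legPoly, eval_mul, eval_C, eval_one_rodPoly,
    Finset.prod_congr rfl fun (i : ℕ) _ => show (k : ℝ) + ((d : ℝ) - 3) / 2 - i =
      k + ((d : ℝ) - 1) / 2 - 1 - i by ring]
  have h1 : (-1 : ℝ) ^ k * (-2) ^ k = 2 ^ k := by rw [← mul_pow]; norm_num
  calc _ = ((-1 : ℝ) ^ k * (-2) ^ k) * (Real.Gamma (((d : ℝ) - 1) / 2) *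
        ∏ i ∈ Finset.range k, (k + ((d : ℝ) - 1) / 2 - 1 - i)) /
        (2 ^ k * Real.Gamma ((k : ℝ) + ((d : ℝ) - 1) / 2)) := by ring
    _ = 1 := by rw [h1, ← hG]; exact div_self (mul_ne_zero (by positivity) h0)

theorem coeff_legPoly_ne_zero (k : ℕ) {d : ℕ} (hd : 2 ≤ d) : (legPoly k d).coeff k ≠ 0 := by
  have hd' : (2 : ℝ) ≤ d := by exact_mod_cast hd
  have h0 : Real.Gamma (k + ((d : ℝ) - 1) / 2) ≠ 0 :=
    (Real.Gamma_pos_of_pos (add_pos_of_nonneg_of_pos (by positivity) (by linarith))).ne'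
  have h1 : Real.Gamma (((d : ℝ) - 1) / 2) ≠ 0 := (Real.Gamma_pos_of_pos (by linarith)).ne'
  rw [legPoly, coeff_C_mul, coeff_rodPoly_self]
  refine mul_ne_zero (by positivity) (mul_ne_zero (by simp) (Finset.prod_ne_zero_iff.2 ?_))
  -- Each factor is `2k + d - 3 - i ≥ k > 0`, since `i ≤ k - 1` and `d ≥ 2`.
  intro i hi
  have : (i : ℝ) + 1 ≤ k := by exact_mod_cast Finset.mem_range.1 hi
  have : (0 : ℝ) ≤ i := by positivity
  nlinarith

/-! ### The weight as a probability measure -/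

/-- Integrate the derivative of `t * (1 - t ^ 2) ^ (a + 1)`. -/
theorem integral_rpow_one_sub_sq_succ {a : ℝ} (ha : -(1 / 2) ≤ a) :
    (2 * a + 3) * ∫ t in (-1 : ℝ)..1, (1 - t ^ 2) ^ (a + 1) =
      (2 * a + 2) * ∫ t in (-1 : ℝ)..1, (1 - t ^ 2) ^ a := by
  have h := integral_deriv_mul_rpow_one_sub_sq ha X
  rw [← intervalIntegral.integral_const_mul, ← intervalIntegral.integral_const_mul, ← sub_eq_zero,
    ← h, ← intervalIntegral.integral_sub]
  · refine intervalIntegral.integral_congr fun t ht => ?_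
    rw [uIcc_of_le (by norm_num)] at ht
    simp [rpow_one_sub_sq_succ ha ht]
    ring
  · exact (intervalIntegrable_rpow_one_sub_sq (by linarith)).const_mul _
  · exact (intervalIntegrable_rpow_one_sub_sq ha).const_mul _

/-- The recursion raises the exponent by one, hence `n` by two; the base cases are `arcsin` and the
constant `1`. -/
theorem integral_rpow_one_sub_sq (n : ℕ) :
    ∫ t in (-1 : ℝ)..1, (1 - t ^ 2) ^ (((n : ℝ) - 1) / 2) =
      √Real.pi * Real.Gamma (((n : ℝ) + 1) / 2) / Real.Gamma (((n : ℝ) + 2) / 2) := by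
  induction n using Nat.twoStepInduction with
  | zero =>
    have h := intervalIntegral.integral_eq_sub_of_hasDerivAt_of_le (a := (-1 : ℝ)) (b := 1)
      (f := Real.arcsin) (f' := fun t => (1 - t ^ 2) ^ (((0 : ℕ) - 1 : ℝ) / 2)) (by norm_num)
      Real.continuous_arcsin.continuousOn ?_ (intervalIntegrable_rpow_one_sub_sq (by norm_num))
    · rw [h]
      have := Real.mul_self_sqrt Real.pi_pos.le
      rw [show ((0 : ℕ) + 1 : ℝ) / 2 = 1 / 2 by norm_num, Real.Gamma_one_half_eq, this]
      simp
    · intro t ht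
      refine (Real.hasDerivAt_arcsin ht.1.ne' ht.2.ne).congr_deriv ?_
      have : 0 < 1 - t ^ 2 := by nlinarith [ht.1, ht.2]
      rw [show ((0 : ℕ) - 1 : ℝ) / 2 = -(1 / 2) by norm_num, Real.rpow_neg this.le,
        Real.sqrt_eq_rpow, one_div]
  | one =>
    have h := Real.Gamma_add_one (s := 1 / 2) (by norm_num)
    rw [show ((1 : ℕ) + 2 : ℝ) / 2 = 1 / 2 + 1 by norm_num, h, Real.Gamma_one_half_eq]
    have := (Real.sqrt_pos.2 Real.pi_pos).ne'
    simp
    field_simp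
    norm_num
  | more n h1 _ =>
    have ha : -(1 / 2) ≤ ((n : ℝ) - 1) / 2 := by
      have : (0 : ℝ) ≤ n := by positivity
      linarith
    have h := integral_rpow_one_sub_sq_succ ha
    have hn : (0 : ℝ) < n + 1 := by positivity
    have hn2 : (0 : ℝ) < n + 2 := by positivity
    push_cast
    rw [show ((n : ℝ) + 2 - 1) / 2 = ((n : ℝ) - 1) / 2 + 1 by ring,
      show ((n : ℝ) + 2 + 1) / 2 = ((n : ℝ) + 1) / 2 + 1 by ring,
      show ((n : ℝ) + 2 + 2) / 2 = ((n : ℝ) + 2) / 2 + 1 by ring,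
      Real.Gamma_add_one (by positivity), Real.Gamma_add_one (by positivity)]
    rw [h1] at h
    have hG := (Real.Gamma_pos_of_pos (show 0 < ((n : ℝ) + 2) / 2 by positivity)).ne'
    have e1 : 2 * (((n : ℝ) - 1) / 2) + 3 = n + 2 := by ring
    have e2 : 2 * (((n : ℝ) - 1) / 2) + 2 = n + 1 := by ring
    rw [e1, e2] at h
    rw [← mul_right_inj' hn2.ne', h]
    field_simp

theorem sphereArea_eq (m : ℕ) :
    sphereArea m = 2 * √Real.pi ^ (m + 1) / Real.Gamma (((m : ℝ) + 1) / 2) := by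
  have hG := (Real.Gamma_pos_of_pos (show 0 < ((m : ℝ) + 1) / 2 by positivity)).ne'
  have h2 : (0 : ℝ) ≤ √Real.pi ^ (m + 1) / Real.Gamma (((m : ℝ) + 1) / 2 + 1) := by
    have := (Real.Gamma_pos_of_pos (show 0 < ((m : ℝ) + 1) / 2 + 1 by positivity)).le
    positivity
  rw [sphereArea, Measure.toSphere_real_apply_univ, measureReal_def, EuclideanSpace.volume_ball]
  simp only [ENNReal.ofReal_one, one_pow, one_mul, Fintype.card_fin, finrank_euclideanSpace]
  push_cast
  rw [ENNReal.toReal_ofReal h2, Real.Gamma_add_one (by positivity)]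
  field_simp

theorem sphereArea_pos (m : ℕ) : 0 < sphereArea m := by
  have hG := Real.Gamma_pos_of_pos (show 0 < ((m : ℝ) + 1) / 2 by positivity)
  have := Real.sqrt_pos.2 Real.pi_pos
  rw [sphereArea_eq]
  positivity

theorem half_le_exponent {d : ℕ} (hd : 2 ≤ d) : -(1 / 2) ≤ ((d : ℝ) - 3) / 2 := by
  have hd' : (2 : ℝ) ≤ d := by exact_mod_cast hd
  linarith

theorem integral_weight {d : ℕ} (hd : 2 ≤ d) : ∫ t in (-1 : ℝ)..1, weight d t = 1 := by
  obtain ⟨n, rfl⟩ : ∃ n, d = n + 2 := ⟨d - 2, by omega⟩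
  simp only [weight]
  rw [intervalIntegral.integral_const_mul]
  have h := integral_rpow_one_sub_sq n
  push_cast
  rw [show ((n : ℝ) + 2 - 3) / 2 = ((n : ℝ) - 1) / 2 by ring, h, sphereArea_eq, sphereArea_eq]
  have h1 := (Real.Gamma_pos_of_pos (show 0 < ((n : ℝ) + 1) / 2 by positivity)).ne'
  have h2 := (Real.Gamma_pos_of_pos (show 0 < ((n : ℝ) + 2) / 2 by positivity)).ne'
  have h3 := (Real.sqrt_pos.2 Real.pi_pos).ne'
  push_cast
  rw [show (n : ℝ) + 1 + 1 = n + 2 by ring, pow_succ (√Real.pi) (n + 1)]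
  field_simp

theorem measurable_weight (d : ℕ) : Measurable (weight d) := by
  unfold weight; fun_prop

theorem weight_pos (d : ℕ) {t : ℝ} (ht : t ∈ Ioo (-1 : ℝ) 1) : 0 < weight d t := by
  have : 0 < 1 - t ^ 2 := by nlinarith [ht.1, ht.2]
  exact mul_pos (div_pos (sphereArea_pos _) (sphereArea_pos _)) (Real.rpow_pos_of_pos this _)

theorem weight_nonneg (d : ℕ) {t : ℝ} (ht : t ∈ Icc (-1 : ℝ) 1) : 0 ≤ weight d t := by
  have : 0 ≤ 1 - t ^ 2 := by nlinarith [ht.1, ht.2]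
  exact mul_nonneg (div_pos (sphereArea_pos _) (sphereArea_pos _)).le (Real.rpow_nonneg this _)

theorem integrable_weightMeasure_iff {d : ℕ} {g : ℝ → ℝ} :
    Integrable g (weightMeasure d) ↔
      IntervalIntegrable (fun t => g t * weight d t) volume (-1) 1 := by
  rw [weightMeasure, integrable_withDensity_iff_integrable_smul' (by
    exact (measurable_weight d).ennreal_ofReal) (by simp), ← IntegrableOn,
    intervalIntegrable_iff_integrableOn_Icc_of_le (by norm_num)]
  refine integrableOn_congr_fun (fun t ht => ?_) measurableSet_Icc
  simp only [ENNReal.toReal_ofReal (weight_nonneg d ht), smul_eq_mul, mul_comm]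

theorem integral_weightMeasure (d : ℕ) (g : ℝ → ℝ) :
    ∫ t, g t ∂(weightMeasure d) = ∫ t in (-1 : ℝ)..1, g t * weight d t := by
  rw [weightMeasure, integral_withDensity_eq_integral_toReal_smul
    (by exact (measurable_weight d).ennreal_ofReal) (by simp),
    intervalIntegral.integral_of_le (by norm_num), ← integral_Icc_eq_integral_Ioc]
  refine setIntegral_congr_fun measurableSet_Icc fun t ht => ?_
  simp only [ENNReal.toReal_ofReal (weight_nonneg d ht), smul_eq_mul, mul_comm]

theorem integrable_weightMeasure_of_continuousOn {d : ℕ} (hd : 2 ≤ d) {g : ℝ → ℝ}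
    (hg : ContinuousOn g (Icc (-1) 1)) : Integrable g (weightMeasure d) := by
  rw [integrable_weightMeasure_iff]
  convert (intervalIntegrable_mul_rpow_one_sub_sq (half_le_exponent hd) hg).const_mul
    (sphereArea (d - 2) / sphereArea (d - 1)) using 1
  ext t
  simp only [weight]
  ring

theorem isProbabilityMeasure_weightMeasure {d : ℕ} (hd : 2 ≤ d) :
    IsProbabilityMeasure (weightMeasure d) := by
  have h1 : Integrable (fun _ : ℝ => (1 : ℝ)) (weightMeasure d) :=
    integrable_weightMeasure_of_continuousOn hd continuousOn_const
  have : IsFiniteMeasure (weightMeasure d) := by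
    rcases integrable_const_iff.1 h1 with h | h
    · norm_num at h
    · exact h
  have h2 := integral_weightMeasure d fun _ => 1
  simp only [one_mul, integral_weight hd, integral_const, smul_eq_mul, mul_one] at h2
  refine ⟨?_⟩
  rwa [measureReal_def, ENNReal.toReal_eq_one_iff] at h2

theorem ae_mem_Icc_weightMeasure (d : ℕ) : ∀ᵐ t ∂(weightMeasure d), t ∈ Icc (-1 : ℝ) 1 :=
  (withDensity_absolutelyContinuous _ _).ae_le (ae_restrict_mem measurableSet_Icc)

theorem integrable_eval_weightMeasure {d : ℕ} (hd : 2 ≤ d) (p : ℝ[X]) :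
    Integrable (fun t => p.eval t) (weightMeasure d) :=
  integrable_weightMeasure_of_continuousOn hd p.continuous.continuousOn

/-! ### Moments of the weight -/

theorem integral_deriv_weightMeasure {d : ℕ} (hd : 2 ≤ d) (r : ℝ[X]) :
    ∫ t, (derivative r * (1 - X ^ 2) - C ((d : ℝ) - 1) * X * r).eval t ∂(weightMeasure d) = 0 := by
  have h := integral_deriv_mul_rpow_one_sub_sq (half_le_exponent hd) r
  rw [show 2 * (((d : ℝ) - 3) / 2 + 1) = d - 1 by ring] at h
  simp only [integral_weightMeasure, weight]
  rw [← mul_zero (sphereArea (d - 2) / sphereArea (d - 1)), ← h,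
    ← intervalIntegral.integral_const_mul]
  congr 1
  ext t
  ring

/-- The case `r = X ^ (n + 1)` of the integrated derivative. With the total mass and the first
moment it determines every moment. -/
theorem integral_pow_add_two_weightMeasure {d : ℕ} (hd : 2 ≤ d) (n : ℕ) :
    (n + d) * ∫ t, t ^ (n + 2) ∂(weightMeasure d) = (n + 1) * ∫ t, t ^ n ∂(weightMeasure d) := by
  have h := integral_deriv_weightMeasure hd (X ^ (n + 1))
  have hi (m : ℕ) (c : ℝ) : Integrable (fun t : ℝ => c * t ^ m) (weightMeasure d) :=
    integrable_weightMeasure_of_continuousOn hd (by fun_prop)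
  rw [← integral_const_mul, ← integral_const_mul, eq_comm, ← sub_eq_zero, ← h, ← integral_sub
    (hi _ _) (hi _ _)]
  congr 1
  ext t
  simp
  ring

theorem integral_id_weightMeasure {d : ℕ} (hd : 2 ≤ d) : ∫ t, t ∂(weightMeasure d) = 0 := by
  have h := integral_deriv_weightMeasure hd 1
  have hd' : (2 : ℝ) ≤ d := by exact_mod_cast hd
  simp only [derivative_one, zero_mul, mul_one, zero_sub, eval_neg, eval_mul, eval_C, eval_X,
    integral_neg, neg_eq_zero] at h
  rw [integral_const_mul, mul_eq_zero] at h
  exact h.resolve_left (by linarith)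

/-! ### Orthogonality -/

theorem integral_mul_legPoly {d : ℕ} (hd : 2 ≤ d) (k : ℕ) (r : ℝ[X]) :
    ∫ t, (r * legPoly k d).eval t ∂(weightMeasure d) =
      sphereArea (d - 2) / sphereArea (d - 1) * (Real.Gamma (((d : ℝ) - 1) / 2) /
        (2 ^ k * Real.Gamma ((k : ℝ) + ((d : ℝ) - 1) / 2))) *
      ∫ t in (-1 : ℝ)..1, (derivative^[k] r).eval t * (1 - t ^ 2) ^ (k + ((d : ℝ) - 3) / 2) := by
  have h := integral_mul_rodPoly (a := k + ((d : ℝ) - 3) / 2) (j := k)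
    (by rw [add_sub_cancel_left]; exact half_le_exponent hd) r
  rw [add_sub_cancel_left] at h
  have h1 : ((-1 : ℝ) ^ k) * (-1) ^ k = 1 := by rw [← mul_pow]; simp
  have h2 (I : ℝ) : I = (-1 : ℝ) ^ k * ((-1) ^ k * I) := by rw [← mul_assoc, h1, one_mul]
  rw [h2 (∫ t in (-1 : ℝ)..1, (derivative^[k] r).eval t * (1 - t ^ 2) ^ (k + ((d : ℝ) - 3) / 2)),
    ← h, integral_weightMeasure, ← intervalIntegral.integral_const_mul,
    ← intervalIntegral.integral_const_mul]
  congr 1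
  ext t
  simp only [weight, legPoly, eval_mul, eval_C]
  ring

theorem integral_mul_legPoly_eq_zero {d : ℕ} (hd : 2 ≤ d) {k : ℕ} {r : ℝ[X]}
    (hr : r.degree < k) : ∫ t, (r * legPoly k d).eval t ∂(weightMeasure d) = 0 := by
  rcases eq_or_ne r 0 with rfl | h0
  · simp
  rw [integral_mul_legPoly hd, iterate_derivative_eq_zero
    ((natDegree_lt_iff_degree_lt h0).2 hr)]
  simp

theorem integral_legPoly_mul_legPoly_of_ne {d : ℕ} (hd : 2 ≤ d) {k l : ℕ} (hkl : k ≠ l) :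
    ∫ t, (legPoly k d * legPoly l d).eval t ∂(weightMeasure d) = 0 := by
  have hdeg (j : ℕ) : (legPoly j d).degree ≤ j :=
    natDegree_le_iff_degree_le.1 (natDegree_legPoly_le j d)
  rcases hkl.lt_or_gt with h | h
  · exact integral_mul_legPoly_eq_zero hd ((hdeg k).trans_lt (by exact_mod_cast h))
  · rw [mul_comm]
    exact integral_mul_legPoly_eq_zero hd ((hdeg l).trans_lt (by exact_mod_cast h))

/-! ### Normalization -/

theorem harmonicDim_zero (n : ℕ) : harmonicDim 0 (n + 2) = 1 := by
  have h : ((1 - PowerSeries.X : PowerSeries ℝ) ^ (n + 1))⁻¹ =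
      PowerSeries.mk fun m => ((n + m).choose n : ℝ) := by
    rw [PowerSeries.inv_eq_iff_mul_eq_one (by simp)]
    exact (PowerSeries.invOneSubPow ℝ (n + 1)).val_inv
  rw [harmonicDim, show n + 2 - 1 = n + 1 by omega, h]
  simp [add_mul]

theorem harmonicDim_succ (k n : ℕ) :
    harmonicDim (k + 1) (n + 2) = ((n + (k + 1)).choose n : ℝ) + ((n + k).choose n : ℝ) := by
  have h : ((1 - PowerSeries.X : PowerSeries ℝ) ^ (n + 1))⁻¹ =
      PowerSeries.mk fun m => ((n + m).choose n : ℝ) := by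
    rw [PowerSeries.inv_eq_iff_mul_eq_one (by simp)]
    exact (PowerSeries.invOneSubPow ℝ (n + 1)).val_inv
  rw [harmonicDim, show n + 2 - 1 = n + 1 by omega, h, add_mul, one_mul, map_add,
    PowerSeries.coeff_succ_X_mul]
  simp

theorem harmonicDim_pos (k : ℕ) {d : ℕ} (hd : 2 ≤ d) : 0 < harmonicDim k d := by
  obtain ⟨n, rfl⟩ : ∃ n, d = n + 2 := ⟨d - 2, by omega⟩
  cases k with
  | zero => simp [harmonicDim_zero]
  | succ k =>
    rw [harmonicDim_succ]
    exact_mod_cast Nat.add_pos_left (Nat.choose_pos (by omega)) _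

/-- The ratio of consecutive dimensions, to be matched with `integral_legPoly_mul_self_succ`. It
starts at index 1 because `N_0` has only one binomial term. -/
theorem harmonicDim_succ_mul (k n : ℕ) :
    harmonicDim (k + 2) (n + 2) * ((k + 2) * (2 * k + 2 + n)) =
      harmonicDim (k + 1) (n + 2) * ((k + 1 + n) * (2 * k + 4 + n)) := by
  have h (m : ℕ) : ((n + (m + 1)).choose n : ℝ) * (m + 1) = (n + m).choose n * (n + m + 1) := by
    have := Nat.choose_mul_succ_eq (n + m) n
    rw [show n + m + 1 - n = m + 1 by omega] at this
    exact_mod_cast this.symm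
  rw [harmonicDim_succ, harmonicDim_succ]
  have h1 := h k
  have h2 := h (k + 1)
  push_cast at h2
  have hk : (k : ℝ) + 1 ≠ 0 := by positivity
  have hk2 : (k : ℝ) + 2 ≠ 0 := by positivity
  have e1 := eq_div_of_mul_eq hk h1
  have e2 := eq_div_of_mul_eq (by positivity) h2
  rw [e2, e1]
  field_simp
  ring

/-- The value of the squared norm of the Legendre polynomials that Rodrigues' formula yields. -/
theorem integral_legPoly_mul_self_eq {d : ℕ} (hd : 2 ≤ d) (k : ℕ) :
    ∫ t, (legPoly k d * legPoly k d).eval t ∂(weightMeasure d) =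
      sphereArea (d - 2) / sphereArea (d - 1) * (Real.Gamma (((d : ℝ) - 1) / 2) /
        (2 ^ k * Real.Gamma ((k : ℝ) + ((d : ℝ) - 1) / 2))) ^ 2 * k.factorial *
      (∏ i ∈ Finset.range k, (2 * k + d - 3 - i : ℝ)) *
      ∫ t in (-1 : ℝ)..1, (1 - t ^ 2) ^ (k + ((d : ℝ) - 3) / 2) := by
  have h : derivative^[k] (legPoly k d) = C (k.factorial * (legPoly k d).coeff k) := by
    rw [eq_C_of_natDegree_le_zero (p := derivative^[k] (legPoly k d)), coeff_iterate_derivative]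
    · simp [Nat.descFactorial_self]
    · exact (natDegree_iterate_derivative _ _).trans (by have := natDegree_legPoly_le k d; omega)
  rw [integral_mul_legPoly hd, h]
  simp only [eval_C]
  rw [intervalIntegral.integral_const_mul, legPoly, coeff_C_mul, coeff_rodPoly_self]
  have h1 : ((-1 : ℝ) ^ k) * (-1) ^ k = 1 := by rw [← mul_pow]; simp
  rw [Finset.prod_congr rfl fun (i : ℕ) _ => show 2 * ((k : ℝ) + ((d : ℝ) - 3) / 2) - i =
    2 * k + d - 3 - i by ring]
  linear_combination (sphereArea (d - 2) / sphereArea (d - 1) * (Real.Gamma (((d : ℝ) - 1) / 2) /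
        (2 ^ k * Real.Gamma ((k : ℝ) + ((d : ℝ) - 1) / 2))) ^ 2 * k.factorial *
      (∏ i ∈ Finset.range k, (2 * k + d - 3 - i : ℝ)) *
      ∫ t in (-1 : ℝ)..1, (1 - t ^ 2) ^ (k + ((d : ℝ) - 3) / 2)) * h1

/-- Two ways of splitting a product of `k + 1` factors: off the last or off the first. -/
theorem prod_range_sub_succ (x : ℝ) (k : ℕ) :
    (∏ i ∈ Finset.range k, (x + 1 - i)) * (x + 1 - k) =
      (x + 1) * ∏ i ∈ Finset.range k, (x - i) := by
  rw [← Finset.prod_range_succ, Finset.prod_range_succ', mul_comm]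
  simp

/-- The ratio of consecutive squared norms comes from the recursions for `Gamma`, for the leading
coefficient and for the integral of the power. For `k = n = 0` it degenerates to `0 = 0`. -/
theorem integral_legPoly_mul_self_succ (n k : ℕ) :
    (∫ t, (legPoly (k + 1) (n + 2) * legPoly (k + 1) (n + 2)).eval t ∂(weightMeasure (n + 2))) *
      ((k + n) * (2 * k + n + 2)) =
    (∫ t, (legPoly k (n + 2) * legPoly k (n + 2)).eval t ∂(weightMeasure (n + 2))) *
      ((k + 1) * (2 * k + n)) := by
  have hI := integral_rpow_one_sub_sq_succ (a := k + (((n + 2 : ℕ) : ℝ) - 3) / 2) (by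
    have : (0 : ℝ) ≤ k := by positivity
    have : (0 : ℝ) ≤ n := by positivity
    push_cast
    linarith)
  have hP1 := prod_range_sub_succ (2 * k + n - 1) k
  have hG : Real.Gamma ((k + 1 : ℕ) + (((n + 2 : ℕ) : ℝ) - 1) / 2) =
      (k + ((n : ℝ) + 1) / 2) * Real.Gamma (k + (((n + 2 : ℕ) : ℝ) - 1) / 2) := by
    rw [show ((k + 1 : ℕ) : ℝ) + (((n + 2 : ℕ) : ℝ) - 1) / 2 = k + ((n : ℝ) + 1) / 2 + 1 by
      push_cast; ring, Real.Gamma_add_one (by positivity)]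
    congr 2
    push_cast
    ring
  have hG0 : Real.Gamma (k + (((n + 2 : ℕ) : ℝ) - 1) / 2) ≠ 0 := by
    refine (Real.Gamma_pos_of_pos ?_).ne'
    push_cast
    rw [show (k : ℝ) + (n + 2 - 1) / 2 = k + (n + 1) / 2 by ring]
    positivity
  rw [integral_legPoly_mul_self_eq (by omega), integral_legPoly_mul_self_eq (by omega), hG,
    Finset.prod_range_succ']
  set I1 := ∫ t in (-1 : ℝ)..1, (1 - t ^ 2) ^ ((k + 1 : ℕ) + (((n + 2 : ℕ) : ℝ) - 3) / 2) with hI1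
  have hI1' : I1 = ∫ t in (-1 : ℝ)..1, (1 - t ^ 2) ^ (k + (((n + 2 : ℕ) : ℝ) - 3) / 2 + 1) := by
    rw [hI1]; congr 1; ext t; congr 1; push_cast; ring
  rw [← hI1'] at hI
  set I0 := ∫ t in (-1 : ℝ)..1, (1 - t ^ 2) ^ (k + (((n + 2 : ℕ) : ℝ) - 3) / 2)
  set G := Real.Gamma (k + (((n + 2 : ℕ) : ℝ) - 1) / 2)
  set A := sphereArea (n + 2 - 2) / sphereArea (n + 2 - 1)
  set B := Real.Gamma ((((n + 2 : ℕ) : ℝ) - 1) / 2)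
  have e1 : ∏ i ∈ Finset.range k, (2 * ((k + 1 : ℕ) : ℝ) + (n + 2 : ℕ) - 3 - (i + 1 : ℕ)) =
      ∏ i ∈ Finset.range k, (2 * k + n - 1 + 1 - i : ℝ) :=
    Finset.prod_congr rfl fun i _ => by push_cast; ring
  have e2 : ∏ i ∈ Finset.range k, (2 * (k : ℝ) + (n + 2 : ℕ) - 3 - i) =
      ∏ i ∈ Finset.range k, (2 * k + n - 1 - i : ℝ) :=
    Finset.prod_congr rfl fun i _ => by push_cast; ring
  rw [e1, e2]
  set Q1 := ∏ i ∈ Finset.range k, (2 * k + n - 1 + 1 - i : ℝ)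
  set Q0 := ∏ i ∈ Finset.range k, (2 * k + n - 1 - i : ℝ)
  rw [Nat.factorial_succ]
  push_cast at hI ⊢
  have hQ : Q1 * (k + n) = (2 * k + n) * Q0 := by linear_combination hP1
  have hI' : I1 * (2 * k + n + 2) = (2 * k + n + 1) * I0 := by linear_combination hI
  have hx : (2 * (k : ℝ) + n + 1) ≠ 0 := by positivity
  have e3 : B / (2 ^ (k + 1) * ((k + (n + 1) / 2) * G)) = B / (2 ^ k * G) / (2 * k + n + 1) := by
    rw [pow_succ]
    field_simp
    ring
  rw [e3]
  have e4 : 2 * ((k : ℝ) + 1) + (n + 2) - 3 - (0 : ℝ) = 2 * k + n + 1 := by ring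
  set F := B / (2 ^ k * G)
  calc _ = A * F ^ 2 * ((k + 1) * k.factorial) / (2 * k + n + 1) ^ 2 * (2 * k + n + 1) *
        (Q1 * (k + n)) * (I1 * (2 * k + n + 2)) := by
        simp only [e4]
        generalize 2 * (k : ℝ) + n + 1 = y
        ring
    _ = _ := by
      rw [hQ, hI']
      field_simp

theorem integral_legPoly_zero_mul_self {d : ℕ} (hd : 2 ≤ d) :
    ∫ t, (legPoly 0 d * legPoly 0 d).eval t ∂(weightMeasure d) = 1 := by
  have h : legPoly 0 d = 1 := by
    have h1 := eval_one_legPoly 0 hd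
    rw [eq_C_of_natDegree_le_zero (natDegree_legPoly_le 0 d), eval_C] at h1
    rw [eq_C_of_natDegree_le_zero (natDegree_legPoly_le 0 d), h1, C_1]
  have := isProbabilityMeasure_weightMeasure hd
  simp [h]

/-- Degree at most one, mean zero, and value `1` at `1` leave no choice. -/
theorem legPoly_one {d : ℕ} (hd : 2 ≤ d) : legPoly 1 d = X := by
  have h1 := eval_one_legPoly 1 hd
  have h0 := integral_mul_legPoly_eq_zero hd (k := 1) (r := 1) (by simp)
  have := isProbabilityMeasure_weightMeasure hd
  obtain ⟨a, b, hab⟩ := exists_eq_X_add_C_of_natDegree_le_one (natDegree_legPoly_le 1 d)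
  have hi : Integrable (fun t : ℝ => t) (weightMeasure d) :=
    integrable_weightMeasure_of_continuousOn hd continuousOn_id
  simp only [hab, one_mul, eval_add, eval_mul, eval_C, eval_X, mul_one] at h0 h1
  rw [integral_add (hi.const_mul a) (integrable_const b), integral_const_mul,
    integral_id_weightMeasure hd] at h0
  have hb : b = 0 := by simpa using h0
  have ha : a = 1 := by linarith
  simp [hab, ha, hb]

theorem integral_legPoly_mul_self {d : ℕ} (hd : 2 ≤ d) (k : ℕ) :
    ∫ t, (legPoly k d * legPoly k d).eval t ∂(weightMeasure d) = (harmonicDim k d)⁻¹ := by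
  obtain ⟨n, rfl⟩ : ∃ n, d = n + 2 := ⟨d - 2, by omega⟩
  refine eq_inv_of_mul_eq_one_left ?_
  induction k with
  | zero => rw [integral_legPoly_zero_mul_self hd, harmonicDim_zero, one_mul]
  | succ k ih =>
    rcases k with _ | k
    -- The ratio recursion says nothing here when `d = 2`, so the second moment is computed
    -- directly.
    · have h := integral_pow_add_two_weightMeasure hd 0
      have := isProbabilityMeasure_weightMeasure hd
      rw [harmonicDim_succ, zero_add, legPoly_one hd]
      simp only [← pow_two]
      simp only [CharP.cast_eq_zero, zero_add, pow_zero, integral_const, probReal_univ, smul_eq_mul,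
        mul_one] at h
      rw [← h]
      simp [Nat.choose_succ_self_right]
      ring
    · have h1 := integral_legPoly_mul_self_succ n (k + 1)
      have h2 := harmonicDim_succ_mul k n
      push_cast at h1
      have hx : ((k : ℝ) + 1 + n) * (2 * k + 4 + n) * ((k + 2) * (2 * k + 2 + n)) ≠ 0 := by
        positivity
      rw [← mul_left_inj' hx]
      linear_combination (harmonicDim (k + 2) (n + 2) * ((k + 2) * (2 * k + 2 + n))) * h1 +
        ((∫ t, (legPoly (k + 1) (n + 2) * legPoly (k + 1) (n + 2)).eval t
          ∂(weightMeasure (n + 2))) * ((k + 2) * (2 * k + 2 + n))) * h2 +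
        ((k + 1 + n) * (2 * k + 4 + n) * ((k + 2) * (2 * k + 2 + n)) : ℝ) * ih

/-! ### Rotation invariance of the uniform measure on the sphere -/

/-- The restriction of a linear isometry to the unit sphere. -/
noncomputable def sphereEquiv {d : ℕ}
    (U : EuclideanSpace ℝ (Fin d) ≃ₗᵢ[ℝ] EuclideanSpace ℝ (Fin d)) : Sph d ≃ₜ Sph d where
  toFun ξ := ⟨U ξ, by simp⟩
  invFun ξ := ⟨U.symm ξ, by simp⟩
  left_inv ξ := by simp
  right_inv ξ := by simp
  continuous_toFun := by fun_prop
  continuous_invFun := by fun_prop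

open scoped Pointwise in
-- Surface measure is a multiple of the volume of the cone over a set, and `U` maps cones to cones
-- preserving volume.
theorem measurePreserving_sphereEquiv {d : ℕ}
    (U : EuclideanSpace ℝ (Fin d) ≃ₗᵢ[ℝ] EuclideanSpace ℝ (Fin d)) :
    MeasurePreserving (sphereEquiv U).toMeasurableEquiv (unifSphere d) (unifSphere d) := by
  refine MeasurePreserving.smul_measure ⟨(sphereEquiv U).toMeasurableEquiv.measurable, ?_⟩ _
  ext s hs
  have hs' := (sphereEquiv U).toMeasurableEquiv.measurable hs
  have hU : MeasurePreserving U.toHomeomorph.toMeasurableEquiv volume volume := U.measurePreserving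
  rw [MeasurableEquiv.map_apply, Measure.toSphere_apply' _ hs', Measure.toSphere_apply' _ hs,
    ← hU.measure_preimage_equiv (Ioo (0 : ℝ) 1 • (Subtype.val '' s))]
  congr 2
  ext x
  simp only [Set.mem_smul, mem_image, mem_preimage]
  constructor
  · rintro ⟨r, hr, _, ⟨ξ, hξ, rfl⟩, h⟩
    refine ⟨r, hr, _, ⟨_, hξ, rfl⟩, ?_⟩
    rw [← h]
    exact (U.map_smul r (ξ : EuclideanSpace ℝ (Fin d))).symm
  · rintro ⟨r, hr, _, ⟨ξ, hξ, rfl⟩, h⟩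
    refine ⟨r, hr, _, ⟨(sphereEquiv U).symm ξ, ?_, rfl⟩, ?_⟩
    · change sphereEquiv U ((sphereEquiv U).symm ξ) ∈ s
      rwa [Homeomorph.apply_symm_apply]
    · apply U.injective
      change U (r • U.symm (ξ : EuclideanSpace ℝ (Fin d))) = U x
      rw [U.map_smul, U.apply_symm_apply]
      exact h

theorem integral_sphere_comp {d : ℕ}
    (U : EuclideanSpace ℝ (Fin d) ≃ₗᵢ[ℝ] EuclideanSpace ℝ (Fin d))
    (F : EuclideanSpace ℝ (Fin d) → ℝ) :
    ∫ ξ : Sph d, F (U ξ) ∂(unifSphere d) = ∫ ξ : Sph d, F ξ ∂(unifSphere d) :=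
  (measurePreserving_sphereEquiv U).integral_comp' fun ξ : Sph d => F ξ

theorem isProbabilityMeasure_unifSphere {d : ℕ} (hd : 2 ≤ d) :
    IsProbabilityMeasure (unifSphere d) := by
  have : Nontrivial (EuclideanSpace ℝ (Fin d)) := by
    have : NeZero d := ⟨by omega⟩
    infer_instance
  refine ⟨?_⟩
  rw [unifSphere, Measure.smul_apply, smul_eq_mul]
  refine ENNReal.inv_mul_cancel ?_ (measure_ne_top _ _)
  rw [Ne, Measure.measure_univ_eq_zero]
  exact Measure.toSphere_ne_zero _

/-- Extend `z` and `y / ‖y‖` to an orthonormal basis and take coordinates. Allowing `y = 0` covers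
the pairs `x = ±z` later. -/
theorem exists_isometry_map_pair {d : ℕ} {i j : Fin d} (hij : i ≠ j)
    {z y : EuclideanSpace ℝ (Fin d)} (hz : ‖z‖ = 1) (hzy : inner ℝ z y = 0) :
    ∃ U : EuclideanSpace ℝ (Fin d) ≃ₗᵢ[ℝ] EuclideanSpace ℝ (Fin d),
      U z = EuclideanSpace.single i 1 ∧ U y = ‖y‖ • EuclideanSpace.single j 1 := by
  classical
  rcases eq_or_ne y 0 with rfl | hy
  · obtain ⟨b, hb⟩ := Orthonormal.exists_orthonormalBasis_extension_of_card_eq (𝕜 := ℝ)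
      (E := EuclideanSpace ℝ (Fin d)) (ι := Fin d) (by simp) (v := fun _ => z) (s := {i}) (by
        refine ⟨fun k => hz, fun k l hkl => ?_⟩
        exact absurd (Subsingleton.elim k l) hkl)
    refine ⟨b.repr, ?_, by simp⟩
    rw [← hb i (by simp), b.repr_self]
  · have hy' : ‖y‖ ≠ 0 := norm_ne_zero_iff.2 hy
    obtain ⟨b, hb⟩ := Orthonormal.exists_orthonormalBasis_extension_of_card_eq (𝕜 := ℝ)
      (E := EuclideanSpace ℝ (Fin d)) (ι := Fin d) (by simp)
      (v := fun k => if k = i then z else ‖y‖⁻¹ • y) (s := {i, j}) (by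
        constructor
        · rintro ⟨k, rfl | rfl⟩
          · simp [hz]
          · simp [hij.symm, norm_smul, hy']
        · rintro ⟨k, rfl | rfl⟩ ⟨l, rfl | rfl⟩ hkl
          · exact absurd rfl hkl
          · simp [hij.symm, inner_smul_right, hzy]
          · simp [hij.symm, inner_smul_left, real_inner_comm, hzy]
          · exact absurd rfl hkl)
    refine ⟨b.repr, ?_, ?_⟩
    · have := hb i (by simp)
      simp only [if_true] at this
      rw [← this, b.repr_self]
    · have := hb j (by simp)
      simp only [hij.symm, if_false] at this
      have h2 : y = ‖y‖ • b j := by rw [this, smul_smul, mul_inv_cancel₀ hy', one_smul]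
      conv_lhs => rw [h2]
      rw [b.repr.map_smul, b.repr_self]

theorem integral_inner_pair {d : ℕ} {i j : Fin d} (hij : i ≠ j)
    {z y : EuclideanSpace ℝ (Fin d)} (hz : ‖z‖ = 1) (hzy : inner ℝ z y = 0) (F : ℝ → ℝ → ℝ) :
    ∫ ξ : Sph d, F (inner ℝ (ξ : EuclideanSpace ℝ (Fin d)) z)
      (inner ℝ (ξ : EuclideanSpace ℝ (Fin d)) y) ∂(unifSphere d) =
    ∫ ξ : Sph d, F ((ξ : EuclideanSpace ℝ (Fin d)) i) (‖y‖ * (ξ : EuclideanSpace ℝ (Fin d)) j)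
      ∂(unifSphere d) := by
  obtain ⟨U, h1, h2⟩ := exists_isometry_map_pair hij hz hzy
  rw [← integral_sphere_comp U fun v => F (v i) (‖y‖ * v j)]
  congr 1
  ext ξ
  rw [← U.inner_map_map ξ z, h1, ← U.inner_map_map ξ y, h2]
  simp [inner_smul_right, EuclideanSpace.inner_single_right]

theorem integral_inner_single {d : ℕ} (hd : 2 ≤ d) (i : Fin d) {y : EuclideanSpace ℝ (Fin d)}
    (F : ℝ → ℝ) :
    ∫ ξ : Sph d, F (inner ℝ (ξ : EuclideanSpace ℝ (Fin d)) y) ∂(unifSphere d) =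
    ∫ ξ : Sph d, F (‖y‖ * (ξ : EuclideanSpace ℝ (Fin d)) i) ∂(unifSphere d) := by
  have : Nontrivial (Fin d) := Fin.nontrivial_iff_two_le.2 hd
  obtain ⟨j, hj⟩ := exists_ne i
  rcases eq_or_ne y 0 with rfl | hy
  · simp
  · have hy' : ‖y‖ ≠ 0 := norm_ne_zero_iff.2 hy
    have h := integral_inner_pair hj.symm (z := ‖y‖⁻¹ • y) (y := 0) (by simp [norm_smul, hy'])
      (by simp) fun a _ => F (‖y‖ * a)
    rw [← h]
    congr 1
    ext ξ
    rw [inner_smul_right, mul_inv_cancel_left₀ hy']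

theorem integrable_unifSphere_of_continuous {d : ℕ} (hd : 2 ≤ d) {g : Sph d → ℝ}
    (hg : Continuous g) : Integrable g (unifSphere d) := by
  have := isProbabilityMeasure_unifSphere hd
  exact hg.integrable_of_hasCompactSupport (HasCompactSupport.of_compactSpace g)

/-! ### Moments of a coordinate -/

theorem integral_coord_pow_of_odd {d : ℕ} (i : Fin d) {n : ℕ} (hn : Odd n) :
    ∫ ξ : Sph d, (ξ : EuclideanSpace ℝ (Fin d)) i ^ n ∂(unifSphere d) = 0 := by
  have h := integral_sphere_comp (LinearIsometryEquiv.neg ℝ)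
    (fun ξ : EuclideanSpace ℝ (Fin d) => ξ i ^ n)
  simp only [LinearIsometryEquiv.coe_neg, PiLp.neg_apply, hn.neg_pow, integral_neg] at h
  linarith

/-- The second order term in `s` of `𝔼 (ξ i + s * ξ j) ^ (2 * m) = (1 + s ^ 2) ^ m * 𝔼 (ξ i) ^ (2 * m)`. -/
theorem integral_coord_pow_mul_sq {d : ℕ} (hd : 2 ≤ d) {i j : Fin d} (hij : i ≠ j) (m : ℕ) :
    (2 * m + 1) * ∫ ξ : Sph d, (ξ : EuclideanSpace ℝ (Fin d)) i ^ (2 * m) *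
      (ξ : EuclideanSpace ℝ (Fin d)) j ^ 2 ∂(unifSphere d) =
    ∫ ξ : Sph d, (ξ : EuclideanSpace ℝ (Fin d)) i ^ (2 * m + 2) ∂(unifSphere d) := by
  classical
  set A : ℕ → ℝ := fun k => ∫ ξ : Sph d, (ξ : EuclideanSpace ℝ (Fin d)) j ^ k *
    (ξ : EuclideanSpace ℝ (Fin d)) i ^ (2 * m + 2 - k) ∂(unifSphere d) with hA
  set E := ∫ ξ : Sph d, (ξ : EuclideanSpace ℝ (Fin d)) i ^ (2 * m + 2) ∂(unifSphere d)
  have key (s : ℝ) : ∑ k ∈ Finset.range (2 * m + 2 + 1), s ^ k * (((2 * m + 2).choose k : ℝ) * A k) =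
      (1 + s ^ 2) ^ (m + 1) * E := by
    have h := integral_inner_single hd i
      (y := s • EuclideanSpace.single j 1 + EuclideanSpace.single i 1) fun t => t ^ (2 * m + 2)
    have hn : ‖s • EuclideanSpace.single j (1 : ℝ) + EuclideanSpace.single i 1‖ ^ 2 =
        1 + s ^ 2 := by
      rw [norm_add_sq_real]
      simp [inner_smul_left, norm_smul, EuclideanSpace.inner_single_left, hij]
      ring
    simp only [mul_pow, integral_const_mul] at h
    rw [show 2 * m + 2 = 2 * (m + 1) by ring, pow_mul, hn] at h
    rw [← show 2 * m + 2 = 2 * (m + 1) by ring] at h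
    rw [← h]
    simp only [inner_add_right, inner_smul_right, EuclideanSpace.inner_single_right, add_pow]
    rw [integral_finsetSum]
    · refine Finset.sum_congr rfl fun k _ => ?_
      rw [hA, ← integral_const_mul, ← integral_const_mul]
      congr 1
      ext ξ
      simp
      ring
    · intro k _
      exact integrable_unifSphere_of_continuous hd (by simp; fun_prop)
  -- `key` holds for every `s`, hence as an identity of polynomials; the coefficients of `s ^ 2` are
  -- then compared.
  have hpoly : ∑ k ∈ Finset.range (2 * m + 2 + 1),
      (Polynomial.C (((2 * m + 2).choose k : ℝ) * A k) * Polynomial.X ^ k) =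
      Polynomial.C E * (Polynomial.expand ℝ 2 ((1 + Polynomial.X) ^ (m + 1))) := by
    refine Polynomial.funext fun s => ?_
    rw [Polynomial.eval_finsetSum]
    simp only [map_pow, map_add, map_one, Polynomial.expand_X, Polynomial.eval_mul,
      Polynomial.eval_C, Polynomial.eval_pow, Polynomial.eval_X, Polynomial.eval_add,
      Polynomial.eval_one]
    rw [mul_comm E, ← key]
    exact Finset.sum_congr rfl fun k _ => mul_comm _ _
  have h2 := congrArg (fun p => p.coeff 2) hpoly
  simp only [Polynomial.finsetSum_coeff, Polynomial.coeff_C_mul, Polynomial.coeff_X_pow,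
    mul_ite, mul_one, mul_zero] at h2
  rw [Finset.sum_ite_eq, if_pos (by simp), show (2 : ℕ) = 1 * 2 by norm_num,
    Polynomial.coeff_expand_mul (by norm_num), Polynomial.coeff_one_add_X_pow] at h2
  have hc : ((2 * m + 2).choose 2 : ℝ) = (m + 1) * (2 * m + 1) := by
    rw [Nat.cast_choose_two]
    push_cast
    ring
  have hA2 : A 2 = ∫ ξ : Sph d, (ξ : EuclideanSpace ℝ (Fin d)) i ^ (2 * m) *
      (ξ : EuclideanSpace ℝ (Fin d)) j ^ 2 ∂(unifSphere d) := by
    simp only [hA, Nat.add_sub_cancel, mul_comm]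
  simp only [one_mul, Nat.choose_one_right] at h2
  rw [hc, hA2] at h2
  push_cast at h2
  have hm : (m : ℝ) + 1 ≠ 0 := by positivity
  refine mul_left_cancel₀ hm ?_
  linear_combination h2

/-- Insert `∑ j, ξ j ^ 2 = 1`: the term `j = i` is the higher moment, and each of the other `d - 1`
is that moment over `2 * m + 1`. -/
theorem integral_coord_pow_add_two {d : ℕ} (hd : 2 ≤ d) (i : Fin d) (m : ℕ) :
    (2 * m + d) * ∫ ξ : Sph d, (ξ : EuclideanSpace ℝ (Fin d)) i ^ (2 * m + 2) ∂(unifSphere d) =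
    (2 * m + 1) * ∫ ξ : Sph d, (ξ : EuclideanSpace ℝ (Fin d)) i ^ (2 * m) ∂(unifSphere d) := by
  classical
  have h1 : ∫ ξ : Sph d, (ξ : EuclideanSpace ℝ (Fin d)) i ^ (2 * m) ∂(unifSphere d) =
      ∑ j, ∫ ξ : Sph d, (ξ : EuclideanSpace ℝ (Fin d)) i ^ (2 * m) *
        (ξ : EuclideanSpace ℝ (Fin d)) j ^ 2 ∂(unifSphere d) := by
    rw [← integral_finsetSum]
    · congr 1
      ext ξ
      have : ‖(ξ : EuclideanSpace ℝ (Fin d))‖ ^ 2 = 1 := by simp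
      rw [EuclideanSpace.norm_sq_eq] at this
      simp only [Real.norm_eq_abs, sq_abs] at this
      rw [← Finset.mul_sum, this, mul_one]
    · intro j _
      exact integrable_unifSphere_of_continuous hd (by fun_prop)
  rw [h1, Finset.mul_sum, ← Finset.add_sum_erase _ _ (Finset.mem_univ i),
    Finset.sum_congr rfl fun j hj => integral_coord_pow_mul_sq hd (Finset.ne_of_mem_erase hj).symm m]
  rw [Finset.sum_const, Finset.card_erase_of_mem (Finset.mem_univ i)]
  simp only [← pow_add, Finset.card_univ, Fintype.card_fin, nsmul_eq_mul]
  rw [Nat.cast_sub (by omega)]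
  push_cast
  ring

theorem integral_coord_pow {d : ℕ} (hd : 2 ≤ d) (i : Fin d) (n : ℕ) :
    ∫ ξ : Sph d, (ξ : EuclideanSpace ℝ (Fin d)) i ^ n ∂(unifSphere d) =
      ∫ t, t ^ n ∂(weightMeasure d) := by
  have hp1 := isProbabilityMeasure_unifSphere hd
  have hp2 := isProbabilityMeasure_weightMeasure hd
  rcases Nat.even_or_odd' n with ⟨m, rfl | rfl⟩
  · induction m with
    | zero => simp
    | succ m ih =>
      have h1 := integral_coord_pow_add_two hd i m
      have h2 := integral_pow_add_two_weightMeasure hd (2 * m)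
      push_cast at h2
      rw [ih, ← h2] at h1
      have hd' : (2 : ℝ) ≤ d := by exact_mod_cast hd
      exact mul_left_cancel₀ (by positivity) h1
  · rw [integral_coord_pow_of_odd i ⟨m, rfl⟩]
    induction m with
    | zero => simpa using (integral_id_weightMeasure hd).symm
    | succ m ih =>
      have h2 := integral_pow_add_two_weightMeasure hd (2 * m + 1)
      rw [← ih, mul_zero] at h2
      have hd' : (2 : ℝ) ≤ d := by exact_mod_cast hd
      exact ((mul_eq_zero.1 h2).resolve_left (by positivity)).symm

/-- A coordinate of a uniform random point of the sphere has density `weight d`. -/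
theorem map_inner_unifSphere {d : ℕ} (hd : 2 ≤ d) (x : Sph d) :
    (unifSphere d).map (fun ξ : Sph d => inner ℝ (ξ : EuclideanSpace ℝ (Fin d))
      (x : EuclideanSpace ℝ (Fin d))) = weightMeasure d := by
  have hp1 := isProbabilityMeasure_unifSphere hd
  have hp2 := isProbabilityMeasure_weightMeasure hd
  have hm : Measurable (fun ξ : Sph d => inner ℝ (ξ : EuclideanSpace ℝ (Fin d))
      (x : EuclideanSpace ℝ (Fin d))) := by fun_prop
  have hp3 := Measure.isProbabilityMeasure_map (μ := unifSphere d) hm.aemeasurable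
  have hmem (ξ : Sph d) : inner ℝ (ξ : EuclideanSpace ℝ (Fin d))
      (x : EuclideanSpace ℝ (Fin d)) ∈ Icc (-1 : ℝ) 1 := by
    rw [mem_Icc, ← abs_le]
    simpa using abs_real_inner_le_norm (ξ : EuclideanSpace ℝ (Fin d))
      (x : EuclideanSpace ℝ (Fin d))
  have hpoly (p : Polynomial ℝ) : ∫ ξ : Sph d, p.eval (inner ℝ (ξ : EuclideanSpace ℝ (Fin d))
      (x : EuclideanSpace ℝ (Fin d))) ∂(unifSphere d) = ∫ t, p.eval t ∂(weightMeasure d) := by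
    simp only [Polynomial.eval_eq_sum_range]
    rw [integral_finsetSum, integral_finsetSum]
    · refine Finset.sum_congr rfl fun n _ => ?_
      rw [integral_const_mul, integral_const_mul, integral_inner_single hd ⟨0, by omega⟩
        fun t => t ^ n]
      simp [integral_coord_pow hd]
    · exact fun n _ => integrable_weightMeasure_of_continuousOn hd (by fun_prop)
    · exact fun n _ => integrable_unifSphere_of_continuous hd (by fun_prop)
  refine ext_of_forall_integral_eq_of_IsFiniteMeasure fun g => ?_
  rw [integral_map hm.aemeasurable g.continuous.aestronglyMeasurable]
  refine eq_of_forall_dist_le fun ε hε => ?_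
  -- Both measures live on `[-1, 1]`, where a polynomial is `ε / 2`-close to `g`, and they agree on
  -- polynomials.
  obtain ⟨p, hp⟩ := exists_polynomial_near_of_continuousOn (-1) 1 g g.continuous.continuousOn
    (ε / 2) (half_pos hε)
  have h1 := norm_integral_le_of_norm_le_const (μ := unifSphere d) (C := ε / 2)
    (f := fun ξ : Sph d => p.eval (inner ℝ (ξ : EuclideanSpace ℝ (Fin d))
      (x : EuclideanSpace ℝ (Fin d))) - g (inner ℝ (ξ : EuclideanSpace ℝ (Fin d))
      (x : EuclideanSpace ℝ (Fin d)))) (ae_of_all _ fun ξ => (hp _ (hmem ξ)).le)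
  have h2 := norm_integral_le_of_norm_le_const (μ := weightMeasure d) (C := ε / 2)
    (f := fun t => p.eval t - g t)
    ((ae_mem_Icc_weightMeasure d).mono fun t ht => (hp _ ht).le)
  rw [integral_sub (integrable_unifSphere_of_continuous hd (by fun_prop))
    (integrable_unifSphere_of_continuous hd (by fun_prop)), hpoly] at h1
  rw [integral_sub (integrable_eval_weightMeasure hd p)
    (integrable_weightMeasure_of_continuousOn hd g.continuous.continuousOn)] at h2
  simp only [probReal_univ, mul_one, Real.norm_eq_abs, abs_le] at h1 h2
  rw [Real.dist_eq, abs_le]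
  constructor <;> linarith

/-! ### Zonal functions -/

/-- The inner product of two points of the sphere. -/
noncomputable abbrev dot {d : ℕ} (x z : Sph d) : ℝ :=
  inner ℝ (x : EuclideanSpace ℝ (Fin d)) (z : EuclideanSpace ℝ (Fin d))

theorem dot_mem_Icc {d : ℕ} (x z : Sph d) : dot x z ∈ Icc (-1 : ℝ) 1 := by
  rw [mem_Icc, ← abs_le]
  simpa using abs_real_inner_le_norm (x : EuclideanSpace ℝ (Fin d))
    (z : EuclideanSpace ℝ (Fin d))

theorem dot_comm {d : ℕ} (x z : Sph d) : dot x z = dot z x := real_inner_comm _ _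

theorem dot_self {d : ℕ} (x : Sph d) : dot x x = 1 := by
  simp [dot]

theorem exists_dot_eq {d : ℕ} (hd : 2 ≤ d) {t : ℝ} (ht : t ∈ Icc (-1 : ℝ) 1) :
    ∃ x z : Sph d, dot x z = t := by
  have : Nontrivial (Fin d) := Fin.nontrivial_iff_two_le.2 hd
  obtain ⟨i, j, hij⟩ := exists_pair_ne (Fin d)
  have h0 : 0 ≤ 1 - t ^ 2 := by nlinarith [ht.1, ht.2]
  have hn : ‖t • EuclideanSpace.single i (1 : ℝ) + √(1 - t ^ 2) • EuclideanSpace.single j 1‖ ^ 2 =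
      1 := by
    rw [norm_add_sq_real]
    simp [norm_smul, inner_smul_left, inner_smul_right, EuclideanSpace.inner_single_left, hij,
      Real.sq_sqrt h0]
  refine ⟨⟨t • EuclideanSpace.single i 1 + √(1 - t ^ 2) • EuclideanSpace.single j 1, ?_⟩,
    ⟨EuclideanSpace.single i 1, by simp⟩, ?_⟩
  · rw [mem_sphere_zero_iff_norm]
    exact (pow_eq_one_iff_of_nonneg (norm_nonneg _) two_ne_zero).1 hn
  · simp [dot, inner_add_left, inner_smul_left, EuclideanSpace.inner_single_left, hij]

theorem measurePreserving_dot {d : ℕ} (hd : 2 ≤ d) (x : Sph d) :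
    MeasurePreserving (fun ξ : Sph d => dot ξ x) (unifSphere d) (weightMeasure d) :=
  ⟨by fun_prop, map_inner_unifSphere hd x⟩

theorem integrable_comp_dot {d : ℕ} (hd : 2 ≤ d) {φ : ℝ → ℝ} (hφ : Integrable φ (weightMeasure d))
    (x : Sph d) : Integrable (fun ξ : Sph d => φ (dot ξ x)) (unifSphere d) :=
  (measurePreserving_dot hd x).integrable_comp_of_integrable hφ

theorem integral_comp_dot {d : ℕ} (hd : 2 ≤ d) {φ : ℝ → ℝ}
    (hφ : AEStronglyMeasurable φ (weightMeasure d)) (x : Sph d) :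
    ∫ ξ : Sph d, φ (dot ξ x) ∂(unifSphere d) = ∫ t, φ t ∂(weightMeasure d) := by
  rw [← map_inner_unifSphere hd x] at hφ ⊢
  rw [integral_map (by fun_prop) hφ]

theorem integrable_mul_of_continuous {X : Type*} [TopologicalSpace X] [CompactSpace X]
    [MeasurableSpace X] [OpensMeasurableSpace X] {ν : Measure X} {f g : X → ℝ}
    (hf : Integrable f ν) (hg : Continuous g) : Integrable (fun x => g x * f x) ν := by
  obtain ⟨C, hC⟩ := isCompact_univ.exists_bound_of_continuousOn hg.continuousOn
  exact hf.bdd_mul hg.measurable.aestronglyMeasurable (ae_of_all _ fun x => hC x (mem_univ x))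

/-- The reflection `ξ j ↦ -ξ j` fixes `ξ i` and flips the sign of the integrand. -/
theorem integral_coord_odd_eq_zero {d : ℕ} {i j : Fin d} (hij : i ≠ j) (φ : ℝ → ℝ) {m : ℕ}
    (hm : Odd m) :
    ∫ ξ : Sph d, (ξ : EuclideanSpace ℝ (Fin d)) j ^ m * φ ((ξ : EuclideanSpace ℝ (Fin d)) i)
      ∂(unifSphere d) = 0 := by
  have h := integral_inner_pair hij (z := EuclideanSpace.single i 1)
    (y := -EuclideanSpace.single j 1) (by simp)
    (by simp [EuclideanSpace.inner_single_left, hij]) fun a b => b ^ m * φ a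
  simp [EuclideanSpace.inner_single_right, hm.neg_pow, integral_neg] at h
  linarith

/-- Write `x = t z + y` with `y ⊥ z`, so `‖y‖² = 1 - t²`, and expand the power. Reflection removes
the odd powers of `‖y‖`, so only polynomials in `t` remain. -/
theorem exists_poly_integral_pow_dot_mul {d : ℕ} (hd : 2 ≤ d) {φ : ℝ → ℝ}
    (hφ : Integrable φ (weightMeasure d)) (n : ℕ) :
    ∃ h : ℝ[X], h.natDegree ≤ n ∧ ∀ x z : Sph d,
      ∫ ξ : Sph d, dot ξ x ^ n * φ (dot ξ z) ∂(unifSphere d) = h.eval (dot x z) := by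
  have : Nontrivial (Fin d) := Fin.nontrivial_iff_two_le.2 hd
  obtain ⟨i, j, hij⟩ := exists_pair_ne (Fin d)
  set A : ℕ → ℝ := fun m => ∫ ξ : Sph d, (ξ : EuclideanSpace ℝ (Fin d)) j ^ m *
    ((ξ : EuclideanSpace ℝ (Fin d)) i ^ (n - m) * φ ((ξ : EuclideanSpace ℝ (Fin d)) i))
    ∂(unifSphere d) with hA
  -- The rounding in `m / 2` is harmless since `A m = 0` for odd `m`.
  refine ⟨∑ m ∈ Finset.range (n + 1), C (n.choose m * A m) *
    (X ^ (n - m) * (1 - X ^ 2) ^ (m / 2)), ?_, fun x z => ?_⟩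
  · refine natDegree_sum_le_of_forall_le _ _ fun m hm => ?_
    refine (natDegree_C_mul_le _ _).trans (natDegree_mul_le.trans ?_)
    have h1 : (X ^ (n - m) : ℝ[X]).natDegree ≤ n - m := natDegree_X_pow_le _
    have h2 : ((1 - X ^ 2 : ℝ[X]) ^ (m / 2)).natDegree ≤ m / 2 * 2 :=
      natDegree_pow_le_of_le _ (by compute_degree)
    have := Finset.mem_range.1 hm
    omega
  · set t := dot x z
    set y : EuclideanSpace ℝ (Fin d) := x - t • (z : EuclideanSpace ℝ (Fin d)) with hy
    have hzy : inner ℝ (z : EuclideanSpace ℝ (Fin d)) y = 0 := by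
      rw [hy, inner_sub_right, inner_smul_right, real_inner_self_eq_norm_sq, real_inner_comm]
      simp [t, dot]
    have hny : ‖y‖ ^ 2 = 1 - t ^ 2 := by
      rw [hy, norm_sub_sq_real, inner_smul_right, norm_smul]
      simp [t, dot]
      ring
    have hφi : Integrable (fun ξ : Sph d => φ ((ξ : EuclideanSpace ℝ (Fin d)) i))
        (unifSphere d) := by
      simpa [dot, EuclideanSpace.inner_single_right] using
        integrable_comp_dot hd hφ ⟨EuclideanSpace.single i 1, by simp⟩
    have h1 := integral_inner_pair hij (z := (z : EuclideanSpace ℝ (Fin d))) (by simp) hzy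
      fun a b => (b + t * a) ^ n * φ a
    have h2 (ξ : Sph d) : inner ℝ (ξ : EuclideanSpace ℝ (Fin d)) y +
        t * inner ℝ (ξ : EuclideanSpace ℝ (Fin d)) (z : EuclideanSpace ℝ (Fin d)) = dot ξ x := by
      rw [hy, inner_sub_right, inner_smul_right, sub_add_cancel]
    simp only [h2] at h1
    rw [h1]
    simp only [add_pow, Finset.sum_mul]
    rw [integral_finsetSum, eval_finsetSum]
    · refine Finset.sum_congr rfl fun m _ => ?_
      have h3 : ∫ ξ : Sph d, (‖y‖ * (ξ : EuclideanSpace ℝ (Fin d)) j) ^ m *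
          (t * (ξ : EuclideanSpace ℝ (Fin d)) i) ^ (n - m) * (n.choose m) *
          φ ((ξ : EuclideanSpace ℝ (Fin d)) i) ∂(unifSphere d) =
          ‖y‖ ^ m * t ^ (n - m) * n.choose m * A m := by
        rw [hA, ← integral_const_mul]
        congr 1
        ext ξ
        ring
      rw [h3]
      simp only [eval_mul, eval_C, eval_pow, eval_X, eval_sub, eval_one]
      rcases Nat.even_or_odd' m with ⟨l, rfl | rfl⟩
      · rw [pow_mul, hny, Nat.mul_div_cancel_left _ two_pos]
        ring
      · have : A (2 * l + 1) = 0 := by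
          exact integral_coord_odd_eq_zero hij (fun a => a ^ (n - (2 * l + 1)) * φ a) ⟨l, rfl⟩
        simp [this]
    · exact fun m _ => integrable_mul_of_continuous hφi (by fun_prop)

/-- The convolution of a polynomial with a zonal function is a zonal polynomial of at most the
same degree. -/
theorem exists_poly_integral_eval_dot_mul {d : ℕ} (hd : 2 ≤ d) {φ : ℝ → ℝ}
    (hφ : Integrable φ (weightMeasure d)) (q : ℝ[X]) :
    ∃ h : ℝ[X], h.natDegree ≤ q.natDegree ∧ ∀ x z : Sph d,
      ∫ ξ : Sph d, q.eval (dot ξ x) * φ (dot ξ z) ∂(unifSphere d) = h.eval (dot x z) := by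
  choose H hH1 hH2 using exists_poly_integral_pow_dot_mul hd hφ
  refine ⟨∑ n ∈ Finset.range (q.natDegree + 1), C (q.coeff n) * H n, ?_, fun x z => ?_⟩
  · refine natDegree_sum_le_of_forall_le _ _ fun n hn => ?_
    have := Finset.mem_range.1 hn
    exact (natDegree_C_mul_le _ _).trans ((hH1 n).trans (by omega))
  · simp only [eval_eq_sum_range (p := q), Finset.sum_mul]
    rw [integral_finsetSum, eval_finsetSum]
    · refine Finset.sum_congr rfl fun n _ => ?_
      rw [eval_mul, eval_C, ← hH2, ← integral_const_mul]
      simp only [mul_assoc]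
    · exact fun n _ => integrable_mul_of_continuous (integrable_comp_dot hd hφ z) (by fun_prop)

/-- The integral depends only on `dot x z`, which is symmetric. -/
theorem integral_eval_dot_mul_comm {d : ℕ} (hd : 2 ≤ d) (q r : ℝ[X]) (x z : Sph d) :
    ∫ ξ : Sph d, q.eval (dot ξ x) * r.eval (dot ξ z) ∂(unifSphere d) =
      ∫ ξ : Sph d, q.eval (dot ξ z) * r.eval (dot ξ x) ∂(unifSphere d) := by
  obtain ⟨h, -, hh⟩ := exists_poly_integral_eval_dot_mul hd (integrable_eval_weightMeasure hd r) q
  rw [hh, hh, dot_comm]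

/-- Convolution with a zonal function is self-adjoint. -/
theorem integral_convolution_mul_comm {d : ℕ} (hd : 2 ≤ d) {φ : ℝ → ℝ}
    (hφ : Integrable φ (weightMeasure d)) {q r h g : ℝ[X]}
    (hh : ∀ x z : Sph d, ∫ ξ : Sph d, q.eval (dot ξ x) * φ (dot ξ z) ∂(unifSphere d) =
      h.eval (dot x z))
    (hg : ∀ x z : Sph d, ∫ ξ : Sph d, r.eval (dot ξ x) * φ (dot ξ z) ∂(unifSphere d) =
      g.eval (dot x z)) :
    ∫ t, (h * r).eval t ∂(weightMeasure d) = ∫ t, (q * g).eval t ∂(weightMeasure d) := by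
  have := isProbabilityMeasure_unifSphere hd
  obtain ⟨z, -, -⟩ := exists_dot_eq hd (show (1 : ℝ) ∈ Icc (-1 : ℝ) 1 by simp)
  -- Each side is a double integral over the sphere. Fubini puts `φ` outside, and the inner integral
  -- is then symmetric in `q` and `r`.
  have key {q r h : ℝ[X]} (hh : ∀ x z : Sph d,
      ∫ ξ : Sph d, q.eval (dot ξ x) * φ (dot ξ z) ∂(unifSphere d) = h.eval (dot x z)) :
      ∫ t, (h * r).eval t ∂(weightMeasure d) =
        ∫ ξ : Sph d, φ (dot ξ z) * ∫ x : Sph d, q.eval (dot x ξ) * r.eval (dot x z)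
          ∂(unifSphere d) ∂(unifSphere d) := by
    rw [← integral_comp_dot hd (h * r).continuous.aestronglyMeasurable z]
    simp only [eval_mul, ← hh, ← integral_mul_const, ← integral_const_mul]
    rw [integral_integral_swap]
    · congr 1
      ext ξ
      congr 1
      ext x
      rw [dot_comm ξ x]
      ring
    · have hi : Integrable (fun p : Sph d × Sph d => φ (dot p.2 z))
          ((unifSphere d).prod (unifSphere d)) :=
        (integrable_comp_dot hd hφ z).comp_snd (unifSphere d)
      refine (integrable_mul_of_continuous hi (g := fun p : Sph d × Sph d =>
        q.eval (dot p.2 p.1) * r.eval (dot p.1 z)) (by fun_prop)).congr (ae_of_all _ fun p => ?_)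
      simp only [Function.uncurry]
      ring
  rw [key hh, mul_comm, key hg]
  congr 1
  ext ξ
  rw [integral_eval_dot_mul_comm hd q r]
  simp only [mul_comm]

/-! ### The Funk–Hecke formula -/

/-- The weight is positive on the open interval, so `F` vanishes almost everywhere there; continuity
does the rest. -/
theorem eqOn_zero_of_integral_sq_eq_zero {d : ℕ} (hd : 2 ≤ d) {F : ℝ → ℝ}
    (hF : ContinuousOn F (Icc (-1) 1)) (h : ∫ t, F t ^ 2 ∂(weightMeasure d) = 0) :
    EqOn F 0 (Icc (-1) 1) := by
  have h1 : (fun t => F t ^ 2) =ᵐ[weightMeasure d] 0 :=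
    (integral_eq_zero_iff_of_nonneg (fun t => sq_nonneg (F t))
      (integrable_weightMeasure_of_continuousOn hd (hF.pow 2))).1 h
  have h2 := (ae_withDensity_iff (measurable_weight d).ennreal_ofReal).1 h1
  refine Measure.eqOn_Icc_of_ae_eq volume (by norm_num) ?_ hF continuousOn_const
  rw [← Measure.restrict_congr_set Ioo_ae_eq_Icc] at h2 ⊢
  filter_upwards [h2, ae_restrict_mem measurableSet_Ioo] with t ht htm
  have := ht (by simpa using weight_pos d htm)
  simpa using this

theorem eq_zero_of_integral_mul_self_eq_zero {d : ℕ} (hd : 2 ≤ d) {r : ℝ[X]}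
    (h : ∫ t, (r * r).eval t ∂(weightMeasure d) = 0) : r = 0 := by
  have h1 := eqOn_zero_of_integral_sq_eq_zero hd r.continuous.continuousOn
    (by simpa only [← pow_two, eval_pow] using h)
  refine eq_zero_of_infinite_isRoot r ((Icc_infinite (show (-1 : ℝ) < 1 by norm_num)).mono ?_)
  exact fun t ht => h1 ht

/-- The Funk–Hecke formula for zonal polynomials. -/
theorem integral_legPoly_dot_mul {d : ℕ} (hd : 2 ≤ d) {φ : ℝ → ℝ}
    (hφ : Integrable φ (weightMeasure d)) (k : ℕ) (x z : Sph d) :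
    ∫ ξ : Sph d, (legPoly k d).eval (dot ξ x) * φ (dot ξ z) ∂(unifSphere d) =
      (∫ t, φ t * (legPoly k d).eval t ∂(weightMeasure d)) * (legPoly k d).eval (dot x z) := by
  obtain ⟨h, hdeg, hh⟩ := exists_poly_integral_eval_dot_mul hd hφ (legPoly k d)
  -- `c` cancels the top coefficient, so `r = h - c P_k` has degree below `k`, and so has its
  -- convolution `g`. Then `⟨h, r⟩ = ⟨P_k, g⟩ = 0` and `⟨P_k, r⟩ = 0`, whence `⟨r, r⟩ = 0`.
  obtain ⟨c, hc⟩ : ∃ c, h = C c * legPoly k d := by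
    set c := h.coeff k / (legPoly k d).coeff k
    refine ⟨c, ?_⟩
    have hr : (h - C c * legPoly k d).degree < k := by
      rw [degree_lt_iff_coeff_zero]
      intro m hm
      rcases hm.eq_or_lt with rfl | hm
      · simp [c, div_mul_cancel₀ _ (coeff_legPoly_ne_zero k hd)]
      · have := natDegree_legPoly_le k d
        rw [coeff_sub, coeff_C_mul, coeff_eq_zero_of_natDegree_lt (by omega),
          coeff_eq_zero_of_natDegree_lt (by omega)]
        simp
    rw [← sub_eq_zero]
    set r := h - C c * legPoly k d with hrdef
    rcases eq_or_ne r 0 with h0 | h0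
    · exact h0
    obtain ⟨g, hgdeg, hg⟩ := exists_poly_integral_eval_dot_mul hd hφ r
    have hgk : g.degree < k := by
      have := (natDegree_lt_iff_degree_lt h0).2 hr
      exact degree_le_natDegree.trans_lt (by exact_mod_cast hgdeg.trans_lt this)
    refine eq_zero_of_integral_mul_self_eq_zero hd ?_
    have e1 : ∫ t, (h * r).eval t ∂(weightMeasure d) = 0 := by
      rw [integral_convolution_mul_comm hd hφ hh hg, mul_comm]
      exact integral_mul_legPoly_eq_zero hd hgk
    have e2 := integral_mul_legPoly_eq_zero hd hr
    have e3 : ∀ t, (r * r).eval t = (h * r).eval t - c * (r * legPoly k d).eval t := by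
      intro t
      conv_lhs => rw [eval_mul]
      nth_rw 1 [hrdef]
      simp only [eval_mul, eval_sub, eval_C]
      ring
    simp only [e3]
    rw [integral_sub (integrable_eval_weightMeasure hd _)
      ((integrable_eval_weightMeasure hd _).const_mul _), integral_const_mul, e1, e2]
    simp
  -- The eigenvalue is read off at `x = z`, where `P_k(1) = 1`.
  have h1 := hh z z
  rw [dot_self, hc, eval_mul, eval_C, eval_one_legPoly k hd, mul_one, integral_comp_dot hd
    (φ := fun t => (legPoly k d).eval t * φ t)
    ((legPoly k d).continuous.aestronglyMeasurable.mul hφ.1)] at h1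
  rw [hh, hc, eval_mul, eval_C, ← h1]
  simp only [mul_comm]

theorem integral_legPoly_dot_mul_legPoly_dot {d : ℕ} (hd : 2 ≤ d) (k : ℕ) (x z : Sph d) :
    ∫ ξ : Sph d, (legPoly k d).eval (dot ξ x) * (legPoly k d).eval (dot ξ z) ∂(unifSphere d) =
      (harmonicDim k d)⁻¹ * (legPoly k d).eval (dot x z) := by
  rw [integral_legPoly_dot_mul hd (integrable_eval_weightMeasure hd _),
    ← integral_legPoly_mul_self hd]
  simp only [eval_mul]

/-- The integral of `(P_k(ξ·x) ± P_k(ξ·z))²` is nonnegative and equals `2 (1 ± P_k(x·z)) / N_k`. -/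
theorem abs_eval_legPoly_le_one {d : ℕ} (hd : 2 ≤ d) (k : ℕ) {t : ℝ} (ht : t ∈ Icc (-1 : ℝ) 1) :
    |(legPoly k d).eval t| ≤ 1 := by
  obtain ⟨x, z, rfl⟩ := exists_dot_eq hd ht
  set p := legPoly k d
  have hN := inv_pos.2 (harmonicDim_pos k hd)
  have h (s : ℝ) : ∫ ξ : Sph d, (p.eval (dot ξ x) + s * p.eval (dot ξ z)) ^ 2 ∂(unifSphere d) =
      (harmonicDim k d)⁻¹ * (1 + s ^ 2 + 2 * s * p.eval (dot x z)) := by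
    have hi (x z : Sph d) : Integrable (fun ξ : Sph d => p.eval (dot ξ x) * p.eval (dot ξ z))
      (unifSphere d) := integrable_unifSphere_of_continuous hd (by fun_prop)
    have e (ξ : Sph d) : (p.eval (dot ξ x) + s * p.eval (dot ξ z)) ^ 2 =
      p.eval (dot ξ x) * p.eval (dot ξ x) + s ^ 2 * (p.eval (dot ξ z) * p.eval (dot ξ z)) +
        2 * s * (p.eval (dot ξ x) * p.eval (dot ξ z)) := by ring
    simp only [e]
    rw [integral_add ((hi _ _).fun_add ((hi _ _).const_mul _)) ((hi _ _).const_mul _),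
      integral_add (hi _ _) ((hi _ _).const_mul _), integral_const_mul, integral_const_mul]
    simp only [p, integral_legPoly_dot_mul_legPoly_dot hd, dot_self, eval_one_legPoly k hd]
    ring
  have hnn (s : ℝ) : 0 ≤ 1 + s ^ 2 + 2 * s * p.eval (dot x z) := by
    refine nonneg_of_mul_nonneg_right ?_ hN
    rw [← h s]
    exact integral_nonneg fun ξ => sq_nonneg _
  rw [abs_le]
  constructor <;> linarith [hnn 1, hnn (-1)]

/-! ### Integrals against a positive definite kernel -/

theorem integral_comp_simpleFunc {X Y : Type*} [MeasurableSpace X] {ν : Measure X}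
    [IsFiniteMeasure ν] (S : SimpleFunc X Y) (g : Y → ℝ) :
    ∫ x, g (S x) ∂ν = ∑ y ∈ S.range, ν.real (S ⁻¹' {y}) * g y := by
  classical
  have h (x : X) : g (S x) = ∑ y ∈ S.range, (S ⁻¹' {y}).indicator (fun _ => g y) x := by
    rw [Finset.sum_eq_single (S x)]
    · simp
    · intro y _ hy
      rw [indicator_of_notMem]
      exact fun h => hy h.symm
    · exact fun h => absurd (S.mem_range_self x) h
  simp only [h]
  rw [integral_finsetSum]
  · refine Finset.sum_congr rfl fun y _ => ?_
    rw [integral_indicator_const _ (S.measurableSet_fiber y), smul_eq_mul]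
  · exact fun y _ => (integrable_const _).indicator (S.measurableSet_fiber y)

theorem continuous_comp_dot {d : ℕ} {f : ℝ → ℝ} (hf : ContinuousOn f (Icc (-1 : ℝ) 1)) :
    Continuous fun p : Sph d × Sph d => f (dot p.1 p.2) :=
  hf.comp_continuous (by fun_prop) fun p => dot_mem_Icc p.1 p.2

theorem sum_sum_kernel_nonneg {d : ℕ} {f : ℝ → ℝ} (hK : IsPosDefKernel d f) (s : Finset (Sph d))
    (v : Sph d → ℝ) : 0 ≤ ∑ x ∈ s, v x * ∑ z ∈ s, v z * f (dot x z) := by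
  have h := (Matrix.PosSemidef.submatrix hK (Subtype.val : s → Sph d)).dotProduct_mulVec_nonneg
    fun x => v x
  rw [← Finset.sum_coe_sort]
  refine h.trans_eq (Finset.sum_congr rfl fun x _ => ?_)
  rw [← Finset.sum_coe_sort s fun z => v z * f (dot (x : Sph d) z)]
  simp only [Pi.star_apply, star_trivial, Matrix.mulVec, dotProduct, Matrix.submatrix_apply,
    innerKernel, mul_comm]

/-- Moving both variables to finitely many points by a simple function turns the integral into a
finite form of the kernel, with coefficients mass times `c`. Dominated convergence passes to the
limit. -/
theorem integral_kernel_nonneg {d : ℕ} (hd : 2 ≤ d) {f : ℝ → ℝ}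
    (hf : ContinuousOn f (Icc (-1 : ℝ) 1)) (hK : IsPosDefKernel d f) {c : Sph d → ℝ}
    (hc : Continuous c) :
    0 ≤ ∫ z : Sph d, c z * ∫ x : Sph d, c x * f (dot x z) ∂(unifSphere d) ∂(unifSphere d) := by
  have := isProbabilityMeasure_unifSphere hd
  obtain ⟨y₀, -, -⟩ := exists_dot_eq hd (show (1 : ℝ) ∈ Icc (-1 : ℝ) 1 by simp)
  set G : Sph d × Sph d → ℝ := fun p => c p.1 * (c p.2 * f (dot p.2 p.1)) with hG
  have hGc : Continuous G := by
    have := (continuous_comp_dot (d := d) hf).comp continuous_swap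
    exact (hc.comp continuous_fst).mul ((hc.comp continuous_snd).mul this)
  obtain ⟨C, hC⟩ := isCompact_univ.exists_bound_of_continuousOn hGc.continuousOn
  have hGi : Integrable G ((unifSphere d).prod (unifSphere d)) :=
    hGc.integrable_of_hasCompactSupport (HasCompactSupport.of_compactSpace G)
  set S : ℕ → SimpleFunc (Sph d) (Sph d) :=
    SimpleFunc.approxOn id measurable_id univ y₀ (mem_univ _)
  have hS (x : Sph d) : Tendsto (fun n => S n x) atTop (𝓝 x) :=
    SimpleFunc.tendsto_approxOn measurable_id (mem_univ _) (by simp)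
  have hm (n : ℕ) : Measurable fun p : Sph d × Sph d => G (S n p.1, S n p.2) :=
    hGc.measurable.comp (((S n).measurable.comp measurable_fst).prodMk
      ((S n).measurable.comp measurable_snd))
  have hlim : Tendsto (fun n => ∫ p : Sph d × Sph d, G (S n p.1, S n p.2)
      ∂((unifSphere d).prod (unifSphere d))) atTop
      (𝓝 (∫ p, G p ∂((unifSphere d).prod (unifSphere d)))) := by
    refine tendsto_integral_of_dominated_convergence (fun _ => C)
      (fun n => (hm n).aestronglyMeasurable) (integrable_const C)
      (fun n => ae_of_all _ fun p => hC _ (mem_univ _)) (ae_of_all _ fun p => ?_)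
    exact (hGc.tendsto p).comp ((hS p.1).prodMk_nhds (hS p.2))
  have h0 : 0 ≤ ∫ p, G p ∂((unifSphere d).prod (unifSphere d)) := by
    refine ge_of_tendsto' hlim fun n => ?_
    have hi : Integrable (fun p : Sph d × Sph d => G (S n p.1, S n p.2))
        ((unifSphere d).prod (unifSphere d)) :=
      Integrable.of_bound (hm n).aestronglyMeasurable C (ae_of_all _ fun p => hC _ (mem_univ _))
    rw [integral_prod _ hi]
    simp only [hG, integral_const_mul]
    rw [integral_comp_simpleFunc (S n) fun z =>
      c z * ∫ x, c (S n x) * f (dot (S n x) z) ∂(unifSphere d)]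
    have e (z : Sph d) : ∫ x, c (S n x) * f (dot (S n x) z) ∂(unifSphere d) =
        ∑ x ∈ (S n).range, (unifSphere d).real (S n ⁻¹' {x}) * (c x * f (dot x z)) :=
      integral_comp_simpleFunc (S n) fun x => c x * f (dot x z)
    simp only [e]
    refine (sum_sum_kernel_nonneg hK (S n).range
      fun x => (unifSphere d).real (S n ⁻¹' {x}) * c x).trans_eq
      (Finset.sum_congr rfl fun z _ => ?_)
    rw [mul_assoc]
    congr 2
    refine Finset.sum_congr rfl fun x _ => ?_
    rw [dot_comm, mul_assoc]
  rw [integral_prod _ hGi] at h0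
  simpa only [hG, integral_const_mul] using h0

/-! ### Expansions in Legendre polynomials -/

theorem exists_eq_sum_legPoly {d : ℕ} (hd : 2 ≤ d) (n : ℕ) {q : ℝ[X]} (hq : q.degree < n) :
    ∃ b : ℕ → ℝ, q = ∑ k ∈ Finset.range n, C (b k) * legPoly k d := by
  induction n generalizing q with
  | zero => exact ⟨0, by simpa using hq⟩
  | succ n ih =>
    set c := q.coeff n / (legPoly n d).coeff n
    obtain ⟨b, hb⟩ := ih (q := q - C c * legPoly n d) (by
      rw [degree_lt_iff_coeff_zero] at hq ⊢
      intro m hm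
      rcases hm.eq_or_lt with rfl | hm
      · simp [c, div_mul_cancel₀ _ (coeff_legPoly_ne_zero n hd)]
      · have := natDegree_legPoly_le n d
        rw [coeff_sub, coeff_C_mul, hq m hm, coeff_eq_zero_of_natDegree_lt (by omega)]
        simp)
    refine ⟨fun k => if k = n then c else b k, ?_⟩
    simp only [Finset.sum_range_succ, if_true]
    rw [← sub_eq_iff_eq_add, hb]
    exact Finset.sum_congr rfl fun k hk => by rw [if_neg (Finset.mem_range.1 hk).ne]

theorem integral_sum_mul_legPoly {d : ℕ} (hd : 2 ≤ d) (n : ℕ) (b : ℕ → ℝ) {k : ℕ} (hk : k < n) :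
    ∫ t, ((∑ j ∈ Finset.range n, C (b j) * legPoly j d) * legPoly k d).eval t ∂(weightMeasure d) =
      b k * (harmonicDim k d)⁻¹ := by
  simp only [Finset.sum_mul, eval_finsetSum, mul_assoc]
  rw [integral_finsetSum]
  · rw [Finset.sum_eq_single k]
    · rw [← integral_legPoly_mul_self hd, ← integral_const_mul]
      simp only [eval_mul, eval_C]
    · intro j _ hj
      have := integral_legPoly_mul_legPoly_of_ne hd hj
      simp only [eval_mul, eval_C, integral_const_mul] at this ⊢
      rw [this, mul_zero]
    · exact fun h => absurd (Finset.mem_range.2 hk) h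
  · exact fun j _ => integrable_eval_weightMeasure hd _

/-- Funk–Hecke makes the inner integral diagonal in the `P_k`; orthogonality evaluates the outer
one. -/
theorem integral_kernel_sum_legPoly {d : ℕ} (hd : 2 ≤ d) {f : ℝ → ℝ}
    (hf : ContinuousOn f (Icc (-1 : ℝ) 1)) (n : ℕ) (b : ℕ → ℝ) {q : ℝ[X]}
    (hq : q = ∑ j ∈ Finset.range n, C (b j) * legPoly j d) (e : Sph d) :
    ∫ z : Sph d, q.eval (dot z e) * ∫ x : Sph d, q.eval (dot x e) * f (dot x z)
      ∂(unifSphere d) ∂(unifSphere d) =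
    ∑ k ∈ Finset.range n, (∫ t, f t * (legPoly k d).eval t ∂(weightMeasure d)) *
      (harmonicDim k d)⁻¹ * b k ^ 2 := by
  have hfi := integrable_weightMeasure_of_continuousOn hd hf
  have h1 (z : Sph d) : ∫ x : Sph d, q.eval (dot x e) * f (dot x z) ∂(unifSphere d) =
      ∑ k ∈ Finset.range n, b k * ((∫ t, f t * (legPoly k d).eval t ∂(weightMeasure d)) *
        (legPoly k d).eval (dot z e)) := by
    simp only [hq, eval_finsetSum, Finset.sum_mul, eval_mul, eval_C, mul_assoc]
    rw [integral_finsetSum]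
    · refine Finset.sum_congr rfl fun k _ => ?_
      rw [integral_const_mul, integral_legPoly_dot_mul hd hfi, dot_comm e z]
    · exact fun k _ => (integrable_mul_of_continuous (integrable_comp_dot hd hfi z)
        (by fun_prop)).const_mul _
  simp only [h1]
  rw [integral_comp_dot hd (φ := fun t => q.eval t * ∑ k ∈ Finset.range n,
    b k * ((∫ t, f t * (legPoly k d).eval t ∂(weightMeasure d)) * (legPoly k d).eval t))
    (Continuous.aestronglyMeasurable (by fun_prop)) e]
  simp only [Finset.mul_sum]
  rw [integral_finsetSum]
  · refine Finset.sum_congr rfl fun k hk => ?_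
    have h2 := integral_sum_mul_legPoly hd n b (Finset.mem_range.1 hk)
    rw [← hq] at h2
    rw [mul_right_comm _ _ (b k ^ 2), pow_two, ← mul_assoc _ (b k) (b k), mul_assoc _ (b k) _, ← h2,
      ← integral_const_mul]
    congr 1
    ext t
    rw [eval_mul]
    ring
  · exact fun k _ => integrable_weightMeasure_of_continuousOn hd (Continuous.continuousOn (by fun_prop))

theorem legendreCoeff_eq {d : ℕ} (f : ℝ → ℝ) (k : ℕ) : legendreCoeff d f k =
    harmonicDim k d * ∫ t, f t * (legPoly k d).eval t ∂(weightMeasure d) := by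
  rw [legendreCoeff, integral_weightMeasure]
  congr 1
  refine intervalIntegral.integral_congr fun t ht => ?_
  rw [uIcc_of_le (by norm_num)] at ht
  simp only [legendreP_eq k d ht]

theorem legendreCoeff_nonneg {d : ℕ} (hd : 2 ≤ d) {f : ℝ → ℝ}
    (hf : ContinuousOn f (Icc (-1 : ℝ) 1)) (hK : IsPosDefKernel d f) (k : ℕ) :
    0 ≤ legendreCoeff d f k := by
  have hN := harmonicDim_pos k hd
  obtain ⟨e, -, -⟩ := exists_dot_eq hd (show (1 : ℝ) ∈ Icc (-1 : ℝ) 1 by simp)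
  have h1 := integral_kernel_sum_legPoly hd hf (k + 1) (fun j => if j = k then 1 else 0)
    (q := legPoly k d) (by simp [apply_ite C, ite_mul]) e
  have h2 := integral_kernel_nonneg hd hf hK (c := fun x => (legPoly k d).eval (dot x e))
    (by fun_prop)
  rw [h1] at h2
  simp only [ite_pow, one_pow, ne_eq, OfNat.ofNat_ne_zero, not_false_eq_true, zero_pow, mul_ite,
    mul_one, mul_zero, Finset.sum_ite_eq', Finset.mem_range, Nat.lt_succ_self, if_true] at h2
  rw [legendreCoeff_eq]
  exact mul_nonneg hN.le (nonneg_of_mul_nonneg_left h2 (inv_pos.2 hN))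

/-! ### Summability of the coefficients -/

theorem weightMeasure_inter_pos {d : ℕ} {u : Set ℝ} (hu : IsOpen u) (h1 : (1 : ℝ) ∈ u) :
    0 < weightMeasure d (u ∩ Icc (-1) 1) := by
  rw [pos_iff_ne_zero, weightMeasure, Ne,
    withDensity_apply_eq_zero (measurable_weight d).ennreal_ofReal]
  refine fun h => ((hu.inter (isOpen_Ioo (a := (-1 : ℝ)) (b := 1))).measure_pos volume ?_).ne' ?_
  · have : (1 : ℝ) ∈ closure (Ioo (-1 : ℝ) 1) := by rw [closure_Ioo (by norm_num)]; simp
    exact mem_closure_iff.1 this u hu h1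
  · rw [Measure.restrict_apply' measurableSet_Icc] at h
    refine measure_mono_null (fun t ht => ?_) h
    exact ⟨⟨by simpa using weight_pos d ht.2, ht.1, Ioo_subset_Icc_self ht.2⟩,
      Ioo_subset_Icc_self ht.2⟩

/-- On `[-1, 1]` the function `1 + t` is nonnegative with its only maximum at `1`, so its normalized
powers concentrate there. -/
theorem tendsto_integral_one_add_pow {d : ℕ} (hd : 2 ≤ d) (q : ℝ[X]) :
    Tendsto (fun m : ℕ => (∫ t, (1 + t) ^ m ∂(weightMeasure d))⁻¹ *
      ∫ t, (1 + t) ^ m * q.eval t ∂(weightMeasure d)) atTop (𝓝 (q.eval 1)) := by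
  have := isProbabilityMeasure_weightMeasure hd
  have h := tendsto_setIntegral_pow_smul_of_unique_maximum_of_isCompact_of_measure_nhdsWithin_pos
    (μ := weightMeasure d) (s := Icc (-1 : ℝ) 1) (x₀ := 1) (c := fun t => 1 + t)
    (g := fun t => q.eval t) isCompact_Icc (fun u hu h1 => weightMeasure_inter_pos hu h1)
    (by fun_prop) (fun y hy h1 => by have := lt_of_le_of_ne hy.2 h1; linarith)
    (fun y hy => by linarith [hy.1]) (by norm_num) (by simp)
    (integrable_eval_weightMeasure hd q).integrableOn q.continuous.continuousWithinAt
  rw [Measure.restrict_eq_self_of_ae_mem (ae_mem_Icc_weightMeasure d)] at h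
  exact h

/-- The left side is the quadratic form of the kernel at the zonal density `(1 + t)^m / I`. Having
degree `m`, it involves only `P_0, …, P_m`; having mass one, it gives at most `sup |f|`. -/
theorem sum_legendreCoeff_mul_sq_le {d : ℕ} (hd : 2 ≤ d) {f : ℝ → ℝ}
    (hf : ContinuousOn f (Icc (-1 : ℝ) 1)) {M : ℝ} (hM : ∀ t ∈ Icc (-1 : ℝ) 1, ‖f t‖ ≤ M) (m : ℕ) :
    ∑ k ∈ Finset.range (m + 1), legendreCoeff d f k *
      ((∫ t, (1 + t) ^ m ∂(weightMeasure d))⁻¹ *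
        ∫ t, (1 + t) ^ m * (legPoly k d).eval t ∂(weightMeasure d)) ^ 2 ≤ M := by
  have := isProbabilityMeasure_weightMeasure hd
  obtain ⟨e, -, -⟩ := exists_dot_eq hd (show (1 : ℝ) ∈ Icc (-1 : ℝ) 1 by simp)
  have hnn {t : ℝ} (ht : t ∈ Icc (-1 : ℝ) 1) : 0 ≤ (1 + t) ^ m :=
    pow_nonneg (by linarith [ht.1]) m
  set I := ∫ t, (1 + t) ^ m ∂(weightMeasure d) with hI
  have hIpos : 0 < I := by
    have hI0 : 0 ≤ I := integral_nonneg_of_ae ((ae_mem_Icc_weightMeasure d).mono fun t ht => hnn ht)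
    refine lt_of_le_of_ne hI0 fun h0 => ?_
    have h1 := (integral_eq_zero_iff_of_nonneg_ae
      ((ae_mem_Icc_weightMeasure d).mono fun t ht => hnn ht)
      (integrable_weightMeasure_of_continuousOn hd (by fun_prop))).1 h0.symm
    have h2 : weightMeasure d (Ioi (0 : ℝ) ∩ Icc (-1) 1) = 0 := by
      refine measure_mono_null (fun t ht => ?_) (ae_iff.1 h1)
      have : (0 : ℝ) < t := ht.1
      have : 0 < (1 + t) ^ m := by positivity
      exact this.ne'
    exact (weightMeasure_inter_pos isOpen_Ioi (by simp)).ne' h2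
  set q : ℝ[X] := (1 + X) ^ m with hqdef
  have hq (t : ℝ) : q.eval t = (1 + t) ^ m := by simp [q]
  have hqdeg : q.degree < (m + 1 : ℕ) := by
    refine (degree_le_of_natDegree_le (n := m) ?_).trans_lt (by exact_mod_cast Nat.lt_succ_self m)
    exact (natDegree_pow_le_of_le m (show (1 + X : ℝ[X]).natDegree ≤ 1 by compute_degree)).trans_eq
      (mul_one m)
  obtain ⟨b, hb⟩ := exists_eq_sum_legPoly hd (m + 1) hqdeg
  have h1 := integral_kernel_sum_legPoly hd hf (m + 1) b hb e
  have h2 : ∑ k ∈ Finset.range (m + 1), (∫ t, f t * (legPoly k d).eval t ∂(weightMeasure d)) *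
      (harmonicDim k d)⁻¹ * b k ^ 2 = ∑ k ∈ Finset.range (m + 1), legendreCoeff d f k *
        (∫ t, (1 + t) ^ m * (legPoly k d).eval t ∂(weightMeasure d)) ^ 2 := by
    refine Finset.sum_congr rfl fun k hk => ?_
    have h3 := integral_sum_mul_legPoly hd (m + 1) b (Finset.mem_range.1 hk)
    rw [← hb] at h3
    simp only [eval_mul, hq] at h3
    rw [h3, legendreCoeff_eq]
    have := (harmonicDim_pos k hd).ne'
    field_simp
  rw [h2] at h1
  have hfi := integrable_weightMeasure_of_continuousOn hd hf
  have hinner (z : Sph d) :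
      ‖∫ x : Sph d, q.eval (dot x e) * f (dot x z) ∂(unifSphere d)‖ ≤ I * M := by
    rw [hI, ← integral_comp_dot hd (φ := fun t => (1 + t) ^ m)
      (Continuous.aestronglyMeasurable (by fun_prop)) e, ← integral_mul_const]
    refine norm_integral_le_of_norm_le
      ((integrable_unifSphere_of_continuous hd (by fun_prop)).mul_const M)
      (ae_of_all _ fun x => ?_)
    rw [norm_mul, hq, Real.norm_of_nonneg (hnn (dot_mem_Icc x e))]
    exact mul_le_mul_of_nonneg_left (hM _ (dot_mem_Icc x z)) (hnn (dot_mem_Icc x e))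
  have houter : ‖∫ z : Sph d, q.eval (dot z e) * ∫ x : Sph d, q.eval (dot x e) * f (dot x z)
      ∂(unifSphere d) ∂(unifSphere d)‖ ≤ I * (I * M) := by
    conv_rhs => rw [hI, ← integral_comp_dot hd (φ := fun t => (1 + t) ^ m)
      (Continuous.aestronglyMeasurable (by fun_prop)) e, ← integral_mul_const]
    refine norm_integral_le_of_norm_le
      ((integrable_unifSphere_of_continuous hd (by fun_prop)).mul_const _)
      (ae_of_all _ fun z => ?_)
    rw [norm_mul, hq, Real.norm_of_nonneg (hnn (dot_mem_Icc z e))]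
    exact mul_le_mul_of_nonneg_left
      ((hinner z).trans_eq (by rw [hI, integral_comp_dot hd (φ := fun t => (1 + t) ^ m)
        (Continuous.aestronglyMeasurable (by fun_prop)) e])) (hnn (dot_mem_Icc z e))
  rw [h1] at houter
  have h4 := (le_abs_self _).trans houter
  calc _ = (I⁻¹) ^ 2 * ∑ k ∈ Finset.range (m + 1), legendreCoeff d f k *
        (∫ t, (1 + t) ^ m * (legPoly k d).eval t ∂(weightMeasure d)) ^ 2 := by
        rw [Finset.mul_sum]
        exact Finset.sum_congr rfl fun k _ => by ring
    _ ≤ (I⁻¹) ^ 2 * (I * (I * M)) := by gcongr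
    _ = M := by field_simp

/-- Keep the first `n` terms of the previous bound, nonnegativity allowing the others to be dropped,
and let `m → ∞`: the squared factors tend to `P_k(1)² = 1`. -/
theorem summable_legendreCoeff {d : ℕ} (hd : 2 ≤ d) {f : ℝ → ℝ}
    (hf : ContinuousOn f (Icc (-1 : ℝ) 1)) (hK : IsPosDefKernel d f) :
    Summable (legendreCoeff d f) := by
  obtain ⟨M, hM⟩ := isCompact_Icc.exists_bound_of_continuousOn hf
  refine summable_of_sum_range_le (c := M) (legendreCoeff_nonneg hd hf hK) fun n => ?_
  have hlim : Tendsto (fun m : ℕ => ∑ k ∈ Finset.range n, legendreCoeff d f k *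
      ((∫ t, (1 + t) ^ m ∂(weightMeasure d))⁻¹ *
        ∫ t, (1 + t) ^ m * (legPoly k d).eval t ∂(weightMeasure d)) ^ 2) atTop
      (𝓝 (∑ k ∈ Finset.range n, legendreCoeff d f k)) := by
    refine tendsto_finsetSum _ fun k _ => ?_
    have := ((tendsto_integral_one_add_pow hd (legPoly k d)).pow 2).const_mul (legendreCoeff d f k)
    simpa [eval_one_legPoly k hd] using this
  refine le_of_tendsto hlim ?_
  filter_upwards [eventually_ge_atTop n] with m hm
  refine le_trans ?_ (sum_legendreCoeff_mul_sq_le hd hf hM m)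
  exact Finset.sum_le_sum_of_subset_of_nonneg (Finset.range_mono (by omega)) fun k _ _ =>
    mul_nonneg (legendreCoeff_nonneg hd hf hK k) (sq_nonneg _)

/-! ### The Legendre series -/

theorem eqOn_zero_of_integral_mul_legPoly_eq_zero {d : ℕ} (hd : 2 ≤ d) {F : ℝ → ℝ}
    (hF : ContinuousOn F (Icc (-1 : ℝ) 1))
    (h : ∀ k, ∫ t, F t * (legPoly k d).eval t ∂(weightMeasure d) = 0) :
    EqOn F 0 (Icc (-1) 1) := by
  have := isProbabilityMeasure_weightMeasure hd
  have hp (q : ℝ[X]) : ∫ t, F t * q.eval t ∂(weightMeasure d) = 0 := by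
    obtain ⟨b, hb⟩ := exists_eq_sum_legPoly hd (q.natDegree + 1)
      (degree_le_natDegree.trans_lt (by exact_mod_cast Nat.lt_succ_self q.natDegree))
    rw [hb]
    simp only [eval_finsetSum, Finset.mul_sum, eval_mul, eval_C]
    rw [integral_finsetSum]
    · refine Finset.sum_eq_zero fun k _ => ?_
      simp only [mul_left_comm _ (b k), integral_const_mul, h, mul_zero]
    · exact fun k _ => integrable_weightMeasure_of_continuousOn hd
        (hF.mul (Continuous.continuousOn (by fun_prop)))
  obtain ⟨B, hB⟩ := isCompact_Icc.exists_bound_of_continuousOn hF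
  have hB0 : 0 ≤ B := (norm_nonneg _).trans (hB 0 (by simp))
  refine eqOn_zero_of_integral_sq_eq_zero hd hF (le_antisymm ?_ (integral_nonneg fun t => sq_nonneg _))
  refine le_of_forall_pos_le_add fun ε hε => ?_
  -- `B + 1` rather than `B`, which may be zero.
  obtain ⟨q, hq⟩ := exists_polynomial_near_of_continuousOn (-1) 1 F hF (ε / (B + 1)) (by positivity)
  have hle : ∫ t, F t ^ 2 - F t * q.eval t ∂(weightMeasure d) ≤
      ∫ _, ε ∂(weightMeasure d) := by
    refine integral_mono_ae (integrable_weightMeasure_of_continuousOn hd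
      ((hF.pow 2).sub (hF.mul q.continuous.continuousOn))) (integrable_const _)
      ((ae_mem_Icc_weightMeasure d).mono fun t ht => ?_)
    calc F t ^ 2 - F t * q.eval t ≤ |F t * (q.eval t - F t)| := by
          rw [← abs_neg]
          exact (le_abs_self _).trans' (le_of_eq (by ring))
      _ ≤ B * (ε / (B + 1)) := by
          rw [abs_mul]
          exact mul_le_mul (hB t ht) (hq t ht).le (abs_nonneg _) hB0
      _ ≤ ε := by
          rw [mul_div_assoc', div_le_iff₀ (by positivity)]
          nlinarith
  rw [integral_sub (f := fun t => F t ^ 2) (g := fun t => F t * q.eval t)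
    (integrable_weightMeasure_of_continuousOn hd (hF.pow 2))
    (integrable_weightMeasure_of_continuousOn hd (hF.mul q.continuous.continuousOn)), hp] at hle
  simpa using hle

/-- Since `|α_k P_k| ≤ α_k`, the series converges uniformly to a continuous `g` with the
coefficients of `f`, and `f - g` is orthogonal to every `P_k`. -/
theorem hasSum_legendreCoeff_mul {d : ℕ} (hd : 2 ≤ d) {f : ℝ → ℝ}
    (hf : ContinuousOn f (Icc (-1 : ℝ) 1)) (hK : IsPosDefKernel d f) {t : ℝ}
    (ht : t ∈ Icc (-1 : ℝ) 1) :
    HasSum (fun k => legendreCoeff d f k * (legPoly k d).eval t) (f t) := by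
  have := isProbabilityMeasure_weightMeasure hd
  set a := legendreCoeff d f
  have ha := summable_legendreCoeff hd hf hK
  have ha0 := legendreCoeff_nonneg hd hf hK
  have hle (k : ℕ) {t : ℝ} (ht : t ∈ Icc (-1 : ℝ) 1) : ‖a k * (legPoly k d).eval t‖ ≤ a k := by
    rw [norm_mul, Real.norm_of_nonneg (ha0 k)]
    exact mul_le_of_le_one_right (ha0 k) (abs_eval_legPoly_le_one hd k ht)
  set g : ℝ → ℝ := fun t => ∑' k, a k * (legPoly k d).eval t with hg
  have hgc : ContinuousOn g (Icc (-1) 1) :=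
    continuousOn_tsum (fun k => by fun_prop) ha fun k t ht => hle k ht
  have hgP (j : ℕ) : ∫ t, g t * (legPoly j d).eval t ∂(weightMeasure d) =
      a j * (harmonicDim j d)⁻¹ := by
    have hs := hasSum_integral_of_summable_integral_norm (μ := weightMeasure d)
      (F := fun k t => a k * (legPoly k d).eval t * (legPoly j d).eval t)
      (fun k => integrable_weightMeasure_of_continuousOn hd (by fun_prop)) (by
        refine Summable.of_nonneg_of_le (fun k => integral_nonneg fun t => norm_nonneg _)
          (fun k => ?_) ha
        refine (integral_mono_ae (g := fun _ => a k) ?_ (integrable_const _) ?_).trans_eq (by simp [a])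
        · exact integrable_weightMeasure_of_continuousOn hd (by fun_prop)
        · filter_upwards [ae_mem_Icc_weightMeasure d] with t ht
          rw [norm_mul]
          exact (mul_le_of_le_one_right (norm_nonneg _) (abs_eval_legPoly_le_one hd j ht)).trans
            (hle k ht))
    have hs2 := hasSum_single (f := fun k => ∫ t, a k * (legPoly k d).eval t *
      (legPoly j d).eval t ∂(weightMeasure d)) j fun k hk => by
        have := integral_legPoly_mul_legPoly_of_ne hd hk
        simp only [eval_mul] at this
        simp only [mul_assoc, integral_const_mul, this, mul_zero]
    simp only [tsum_mul_right] at hs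
    rw [hs.unique hs2, ← integral_legPoly_mul_self hd, ← integral_const_mul]
    simp only [eval_mul, mul_assoc]
  have h0 := eqOn_zero_of_integral_mul_legPoly_eq_zero hd (hf.sub hgc) fun k => by
    simp only [Pi.sub_apply, sub_mul]
    rw [integral_sub, hgP, sub_eq_zero]
    · have := (harmonicDim_pos k hd).ne'
      simp only [a, legendreCoeff_eq]
      field_simp
    · exact integrable_weightMeasure_of_continuousOn hd (hf.mul (by fun_prop))
    · exact integrable_weightMeasure_of_continuousOn hd (hgc.mul (by fun_prop))
  have h1 : f t = g t := sub_eq_zero.1 (h0 ht)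
  rw [h1]
  exact (Summable.of_norm_bounded ha fun k => hle k ht).hasSum

/-! ### The dual activation function -/

theorem inner_toLp_toLp {X : Type*} [MeasurableSpace X] {ν : Measure X} {u v : X → ℝ}
    (hu : MemLp u 2 ν) (hv : MemLp v 2 ν) :
    inner ℝ (hu.toLp u) (hv.toLp v) = ∫ x, u x * v x ∂ν := by
  rw [L2.inner_def]
  refine integral_congr_ae ?_
  filter_upwards [hu.coeFn_toLp, hv.coeFn_toLp] with x h1 h2
  rw [h1, h2]
  simp [mul_comm]

theorem tendsto_integral_mul_of_tendsto_eLpNorm {X : Type*} [MeasurableSpace X] {ν : Measure X}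
    {u : ℕ → X → ℝ} {u' v : X → ℝ} (hu : ∀ n, MemLp (u n) 2 ν) (hu' : MemLp u' 2 ν)
    (hv : MemLp v 2 ν) (h : Tendsto (fun n => eLpNorm (u n - u') 2 ν) atTop (𝓝 0)) :
    Tendsto (fun n => ∫ x, u n x * v x ∂ν) atTop (𝓝 (∫ x, u' x * v x ∂ν)) := by
  have h1 := ((Lp.tendsto_Lp_iff_tendsto_eLpNorm'' u hu u' hu').2 h).inner (𝕜 := ℝ)
    (tendsto_const_nhds (x := hv.toLp v))
  simpa only [inner_toLp_toLp] using h1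

theorem memLp_weightMeasure_of_continuousOn {d : ℕ} (hd : 2 ≤ d) {g : ℝ → ℝ}
    (hg : ContinuousOn g (Icc (-1 : ℝ) 1)) : MemLp g 2 (weightMeasure d) := by
  rw [memLp_two_iff_integrable_sq (integrable_weightMeasure_of_continuousOn hd hg).1]
  exact integrable_weightMeasure_of_continuousOn hd (hg.pow 2)

theorem memLp_eval_legPoly {d : ℕ} (hd : 2 ≤ d) (k : ℕ) :
    MemLp (fun t => (legPoly k d).eval t) 2 (weightMeasure d) :=
  memLp_weightMeasure_of_continuousOn hd (legPoly k d).continuous.continuousOn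

theorem dualPartialSum_eq (d : ℕ) (f : ℝ → ℝ) (n : ℕ) {t : ℝ} (ht : t ∈ Icc (-1 : ℝ) 1) :
    dualPartialSum d f n t = ∑ k ∈ Finset.range n,
      √(legendreCoeff d f k * harmonicDim k d) * (legPoly k d).eval t :=
  Finset.sum_congr rfl fun k _ => by rw [legendreP_eq k d ht]

theorem continuousOn_dualPartialSum (d : ℕ) (f : ℝ → ℝ) (n : ℕ) :
    ContinuousOn (dualPartialSum d f n) (Icc (-1) 1) :=
  ContinuousOn.congr (Continuous.continuousOn (by fun_prop)) fun _ ht => dualPartialSum_eq d f n ht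

theorem orthonormal_legPoly {d : ℕ} (hd : 2 ≤ d) :
    Orthonormal ℝ fun k => √(harmonicDim k d) • (memLp_eval_legPoly hd k).toLp := by
  rw [orthonormal_iff_ite]
  intro k l
  rw [inner_smul_left, inner_smul_right, inner_toLp_toLp]
  split_ifs with h
  · subst h
    have h1 := integral_legPoly_mul_self hd k
    simp only [eval_mul] at h1
    have h2 := harmonicDim_pos k hd
    rw [h1, ← mul_assoc]
    simp [Real.mul_self_sqrt h2.le, h2.ne']
  · have h1 := integral_legPoly_mul_legPoly_of_ne hd h
    simp only [eval_mul] at h1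
    rw [h1, mul_zero, mul_zero]

/-- The terms are `√α_k` times the orthonormal vectors `√N_k P_k`, so summability of `α_k` is what
convergence in `L²` requires. -/
theorem exists_isDualActivation {d : ℕ} (hd : 2 ≤ d) {f : ℝ → ℝ}
    (hf : ContinuousOn f (Icc (-1 : ℝ) 1)) (hK : IsPosDefKernel d f) :
    ∃ σ : ℝ → ℝ, IsDualActivation d f σ := by
  have ha0 := legendreCoeff_nonneg hd hf hK
  set e : ℕ → Lp ℝ 2 (weightMeasure d) :=
    fun k => √(harmonicDim k d) • (memLp_eval_legPoly hd k).toLp with he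
  have horth : Orthonormal ℝ e := orthonormal_legPoly hd
  have hs : Summable fun k => √(legendreCoeff d f k) • e k := by
    have := (horth.orthogonalFamily.summable_iff_norm_sq_summable
      fun k => √(legendreCoeff d f k)).2 (by
        simpa [Real.sq_sqrt (ha0 _)] using summable_legendreCoeff hd hf hK)
    simpa using this
  set g := ∑' k, √(legendreCoeff d f k) • e k
  refine ⟨g, Lp.aestronglyMeasurable g, ?_⟩
  have h1 := (Lp.tendsto_Lp_iff_tendsto_eLpNorm' _ _).1 hs.hasSum.tendsto_sum_nat
  refine h1.congr fun n => eLpNorm_congr_ae ?_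
  refine EventuallyEq.sub ?_ EventuallyEq.rfl
  have hn : ∑ k ∈ Finset.range n, √(legendreCoeff d f k) • e k =
      (memLp_weightMeasure_of_continuousOn hd (continuousOn_dualPartialSum d f n)).toLp := by
    have hi (k : ℕ) : MemLp (fun t => √(legendreCoeff d f k * harmonicDim k d) *
        (legPoly k d).eval t) 2 (weightMeasure d) := (memLp_eval_legPoly hd k).const_mul _
    have hk (k : ℕ) : √(legendreCoeff d f k) • e k = (hi k).toLp := by
      rw [he, smul_smul, ← Real.sqrt_mul (ha0 k)]
      rfl
    induction n with
    | zero =>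
      simp only [Finset.range_zero, Finset.sum_empty]
      exact (MemLp.toLp_zero _).symm
    | succ n ih =>
      rw [Finset.sum_range_succ, ih, hk, ← MemLp.toLp_add, MemLp.toLp_eq_toLp_iff]
      filter_upwards [ae_mem_Icc_weightMeasure d] with t ht
      rw [Pi.add_apply, dualPartialSum_eq d f _ ht, dualPartialSum_eq d f _ ht,
        Finset.sum_range_succ]
  rw [hn]
  exact MemLp.coeFn_toLp _

/-- Some partial sum is in `L²` and at finite distance from `σ`. -/
theorem IsDualActivation.memLp {d : ℕ} (hd : 2 ≤ d) {f σ : ℝ → ℝ} (h : IsDualActivation d f σ) :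
    MemLp σ 2 (weightMeasure d) := by
  obtain ⟨n, hn⟩ := (h.2.eventually_lt_const (show (0 : ENNReal) < 1 by simp)).exists
  have h1 := memLp_weightMeasure_of_continuousOn hd (continuousOn_dualPartialSum d f n)
  have h2 : MemLp (dualPartialSum d f n - σ) 2 (weightMeasure d) :=
    ⟨h1.1.sub h.1, hn.trans ENNReal.one_lt_top⟩
  simpa using h1.sub h2

theorem IsDualActivation.integral_mul_legPoly {d : ℕ} (hd : 2 ≤ d) {f σ : ℝ → ℝ}
    (h : IsDualActivation d f σ) (k : ℕ) :
    ∫ t, σ t * (legPoly k d).eval t ∂(weightMeasure d) =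
      √(legendreCoeff d f k * harmonicDim k d) * (harmonicDim k d)⁻¹ := by
  have h1 := tendsto_integral_mul_of_tendsto_eLpNorm (fun n => memLp_weightMeasure_of_continuousOn hd
    (continuousOn_dualPartialSum d f n)) (h.memLp hd) (memLp_eval_legPoly hd k) h.2
  refine tendsto_nhds_unique h1 (tendsto_const_nhds.congr' ?_)
  filter_upwards [eventually_gt_atTop k] with n hn
  rw [← integral_sum_mul_legPoly hd n (fun k => √(legendreCoeff d f k * harmonicDim k d)) hn]
  refine integral_congr_ae ((ae_mem_Icc_weightMeasure d).mono fun t ht => ?_)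
  simp only [dualPartialSum_eq d f n ht, eval_mul, eval_finsetSum, eval_C]

theorem IsDualActivation.memLp_comp_dot {d : ℕ} (hd : 2 ≤ d) {f σ : ℝ → ℝ}
    (h : IsDualActivation d f σ) (x : Sph d) :
    MemLp (fun ξ : Sph d => σ (dot ξ x)) 2 (unifSphere d) :=
  (h.memLp hd).comp_measurePreserving (measurePreserving_dot hd x)

/-- Only one factor is truncated: Funk–Hecke applies to `σ` itself and gives `√(α_k N_k) · √(α_k
N_k) / N_k = α_k`. -/
theorem IsDualActivation.integral_dualPartialSum_mul {d : ℕ} (hd : 2 ≤ d) {f σ : ℝ → ℝ}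
    (h : IsDualActivation d f σ) (h0 : ∀ k, 0 ≤ legendreCoeff d f k) (n : ℕ) (x z : Sph d) :
    ∫ ξ : Sph d, dualPartialSum d f n (dot ξ x) * σ (dot ξ z) ∂(unifSphere d) =
      ∑ k ∈ Finset.range n, legendreCoeff d f k * (legPoly k d).eval (dot x z) := by
  have := isProbabilityMeasure_weightMeasure hd
  have hσ : Integrable σ (weightMeasure d) := (h.memLp hd).integrable (by norm_num)
  simp only [dualPartialSum_eq d f n (dot_mem_Icc _ x), Finset.sum_mul, mul_assoc]
  rw [integral_finsetSum]
  · refine Finset.sum_congr rfl fun k _ => ?_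
    rw [integral_const_mul, integral_legPoly_dot_mul hd hσ, h.integral_mul_legPoly hd]
    have hN := harmonicDim_pos k hd
    have hs := Real.mul_self_sqrt (mul_nonneg (h0 k) hN.le)
    rw [← mul_assoc, ← mul_assoc, hs, mul_assoc (legendreCoeff d f k), mul_inv_cancel₀ hN.ne',
      mul_one]
  · exact fun k _ => (integrable_mul_of_continuous (integrable_comp_dot hd hσ z)
      (by fun_prop)).const_mul _

/-- Let the truncation grow. `L²` convergence passes to the sphere since `dot · x` preserves
measure, and the Legendre series converges at every point, so the identity holds for every pair. -/
theorem IsDualActivation.integral_mul {d : ℕ} (hd : 2 ≤ d) {f σ : ℝ → ℝ}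
    (hf : ContinuousOn f (Icc (-1 : ℝ) 1)) (hK : IsPosDefKernel d f)
    (h : IsDualActivation d f σ) (x z : Sph d) :
    ∫ ξ : Sph d, σ (dot ξ x) * σ (dot ξ z) ∂(unifSphere d) = f (dot x z) := by
  have hp := measurePreserving_dot hd x
  have hs (n : ℕ) := memLp_weightMeasure_of_continuousOn hd (continuousOn_dualPartialSum d f n)
  have h1 := tendsto_integral_mul_of_tendsto_eLpNorm
    (u := fun n ξ => dualPartialSum d f n (dot ξ x)) (u' := fun ξ => σ (dot ξ x))
    (fun n => (hs n).comp_measurePreserving hp) (h.memLp_comp_dot hd x) (h.memLp_comp_dot hd z)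
    (h.2.congr fun n => (eLpNorm_comp_measurePreserving ((hs n).1.sub h.1) hp).symm)
  refine tendsto_nhds_unique h1 ?_
  simp only [h.integral_dualPartialSum_mul hd (legendreCoeff_nonneg hd hf hK)]
  exact (hasSum_legendreCoeff_mul hd hf hK (dot_mem_Icc x z)).tendsto_sum_nat

theorem IsDualActivation.integral_sq {d : ℕ} (hd : 2 ≤ d) {f σ : ℝ → ℝ}
    (hf : ContinuousOn f (Icc (-1 : ℝ) 1)) (hK : IsPosDefKernel d f)
    (h : IsDualActivation d f σ) : ∫ t, σ t ^ 2 ∂(weightMeasure d) = f 1 := by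
  obtain ⟨x, -, -⟩ := exists_dot_eq hd (show (1 : ℝ) ∈ Icc (-1 : ℝ) 1 by simp)
  have h1 := h.integral_mul hd hf hK x x
  rw [dot_self, integral_comp_dot hd (φ := fun t => σ t * σ t) (h.1.mul h.1) x] at h1
  simpa only [pow_two] using h1

end KernelActivation

theorem theorem5 (d : ℕ) (hd : 2 ≤ d) (f : ℝ → ℝ)
    (hf : ContinuousOn f (Icc (-1 : ℝ) 1))
    (hK : KernelActivation.IsPosDefKernel d f) (hf1 : f 1 = 1) :
    -- the Legendre coefficients are non-negative and `f` is the sum of its Legendre series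
    (∀ k : ℕ, 0 ≤ KernelActivation.legendreCoeff d f k) ∧
    (∀ t ∈ Icc (-1 : ℝ) 1,
      HasSum (fun k : ℕ => KernelActivation.legendreCoeff d f k * KernelActivation.legendreP k d t)
        (f t)) ∧
    -- the dual activation function exists
    (∃ σ : ℝ → ℝ, KernelActivation.IsDualActivation d f σ) ∧
    -- whichever representative is chosen, (i) and (ii) hold
    ∀ σ : ℝ → ℝ, KernelActivation.IsDualActivation d f σ →
      (IntervalIntegrable (fun t => σ t ^ 2 * KernelActivation.weight d t) volume (-1) 1 ∧
        ∫ t in (-1 : ℝ)..1, σ t ^ 2 * KernelActivation.weight d t = 1) ∧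
      ∀ x z : KernelActivation.Sph d,
        Integrable (fun ξ : KernelActivation.Sph d =>
          σ (inner ℝ (ξ : EuclideanSpace ℝ (Fin d)) (x : EuclideanSpace ℝ (Fin d))) *
          σ (inner ℝ (ξ : EuclideanSpace ℝ (Fin d)) (z : EuclideanSpace ℝ (Fin d))))
          (KernelActivation.unifSphere d) ∧
        ∫ ξ : KernelActivation.Sph d,
          σ (inner ℝ (ξ : EuclideanSpace ℝ (Fin d)) (x : EuclideanSpace ℝ (Fin d))) *
          σ (inner ℝ (ξ : EuclideanSpace ℝ (Fin d)) (z : EuclideanSpace ℝ (Fin d)))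
          ∂(KernelActivation.unifSphere d) =
        f (inner ℝ (x : EuclideanSpace ℝ (Fin d)) (z : EuclideanSpace ℝ (Fin d))) := by

  refine ⟨KernelActivation.legendreCoeff_nonneg hd hf hK, fun t ht => ?_,
    KernelActivation.exists_isDualActivation hd hf hK, fun σ hσ => ⟨?_, fun x z => ⟨?_, ?_⟩⟩⟩
  · simp only [KernelActivation.legendreP_eq _ d ht]
    exact KernelActivation.hasSum_legendreCoeff_mul hd hf hK ht
  · refine ⟨KernelActivation.integrable_weightMeasure_iff.1 (hσ.memLp hd).integrable_sq, ?_⟩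
    have h := hσ.integral_sq hd hf hK
    rwa [KernelActivation.integral_weightMeasure d fun t => σ t ^ 2, hf1] at h
  · exact (hσ.memLp_comp_dot hd x).integrable_mul (hσ.memLp_comp_dot hd z)
  · exact hσ.integral_mul hd hf hK x z
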